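/- **Setting.** Let $q\ge 1$ be the local dimension. Let $u$ be a random unitary $q^2\times q^2$ two-site gate on a probability space; if $u$ is constant, the circuit below is space-time invariant, otherwise it is the space-time random circuit with independent gates distributed as $u$. For $\omega=e^{2\pi i/q}$ let $\sigma^{(j,k)}=\sum_{m}\omega^{jm}|m+k\rangle\langle m|$ ($m+k$ mod $q$) be the generalized Pauli matrices; write $\sigma^\mu$ with $\mu=(j,k)$, $0\le j,k<q$. *OTOC.* For $w,\tau\ge1$ take a chain of sites $0,\dots,w+\tau-1$ and independent gates $g_{jk}$ ($0\le j<\tau$, $0\le k<w$) distributed as $u$. The gate $g_{jk}$ belongs to the brick-wall layer $s=j+k$ and acts on the sites $\tau-1-j+k,\ \tau-j+k$; these are the gates in the overlap of the light cones of the two operators below, all others cancel by unitarity. Let $\tilde U(s)$ be the product of the gates in layer $s$, $U=\tilde U(0)\tilde U(1)\cdots\tilde U(w+\tau-2)$, $\sigma^\mu(t)=U^\dagger\sigma^\mu_{\tau}U$ with $\sigma^\mu$ placed at site $\tau$, and $\sigma^\nu$ placed at site $w-1$ (for $w=1$ it is exactly on the light cone). With $\langle X\rangle=q^{-(w+\tau)}\operatorname{tr}X$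 set $$C_{\mu\nu}(w,\tau)=1-\mathbb E\,\big\langle\sigma^\mu(t)^\dagger(\sigma^\nu)^\dagger\sigma^\mu(t)\,\sigma^\nu\big\rangle .$$ *Light-like generator.* On operators $v$ on two copies of a chain of $w$ sites let $$T_w v=\mathbb E\; q^{-1}\operatorname{tr}_{\text{last site}}\!\big[S\,(V\otimes V)^\dagger(\mathbb I\otimes v)(V\otimes V)\big],\qquad V=u_{0,1}u_{1,2}\cdots u_{w-1,w},$$ where $\mathbb I$ is the identity on both copies of a new leftmost site, $S$ swaps the two copies (of the last site in $T_w$, of the whole chain in $F_w$), and $u_{i,i+1}$ are independent gates distributed as $u$. Put $$F_w v=T_wv-q^{-w}\operatorname{tr}(Sv)\,\mathbb I .$$ An eigenvalue of $F_w$ of maximal modulus is called leading, and $z_2(w)$ denotes a leading eigenvalue of $F_w$ (any choice). Let $\varphi(w)$ be the maximum of $N-1$ over the sizes $N$ of the Jordan blocks of $F_w$ that belong to leading eigenvalues. **Corollary.** Suppose that for every width $w\ge1$ there are indices $\mu_w,\nu_w$ with $$\liminf_{\tau\to\infty}\frac{\operatorname{Re}C_{\mu_w\nu_w}(w,\tau)}{\tau^{\varphi(w)}\,|z_2(w)|^{\tau}}>0$$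 (for $z_2(w)=0$ the condition counts as violated). Then for every $w\ge1$: 1. $|z_2(w)|=|z_2(1)|$, and $z_2(1)$ is a leading eigenvalue of $F_w$. Thus $z_2(w)$ may be chosen to be $z_2(1)$, and if the leading eigenvalue of $F_w$ is unique, then $z_2(w)=z_2(1)$. 2. The asymptotic decay rate of the OTOC inside the light cone equals the one on the light cone: for all $\mu,\nu$ that satisfy the liminf condition at width $w$, $$\lim_{\tau\to\infty}|C_{\mu\nu}(w,\tau)|^{1/\tau}=|z_2(1)| .$$ -/

import Mathlib

open Filter Topology MeasureTheory
open scoped Kronecker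

namespace LightLikeOTOC

noncomputable section

/-- Computational basis of a chain of `n` sites, numbered `0, …, n - 1`, with `q` levels per site. -/
abbrev Config (q n : ℕ) : Type := Fin n → Fin q

/-- Operators on a chain of `n` sites. -/
abbrev Op (q n : ℕ) : Type := Matrix (Config q n) (Config q n) ℂ

/-- Two-site unitary gates. -/
abbrev Gate (q : ℕ) : Type := Matrix.unitaryGroup (Fin q × Fin q) ℂ

/-- Index `(j, k)` of a generalized Pauli matrix; the linear label is `j + q * k`. -/
abbrev PauliIndex (q : ℕ) : Type := Fin q × Fin q

/-- Generalized Pauli matrix `σ^{j,k} = ∑ₘ ω^{j m} |m + k⟩⟨m|` with `ω = exp (2 π i / q)`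
and `m + k` taken modulo `q`. -/
def pauli {q : ℕ} [NeZero q] (μ : PauliIndex q) : Matrix (Fin q) (Fin q) ℂ :=
  Matrix.of fun a m =>
    if a = m + μ.2 then
      Complex.exp (2 * (Real.pi : ℂ) * Complex.I / (q : ℂ)) ^ ((μ.1 : ℕ) * (m : ℕ))
    else 0

/-- The one-site operator `A` placed at site `i` of the chain of `n` sites. -/
def siteOp {q : ℕ} (n i : ℕ) (A : Matrix (Fin q) (Fin q) ℂ) : Op q n :=
  if hi : i < n then
    Matrix.of fun a b =>
      if ∀ j : Fin n, (j : ℕ) ≠ i → a j = b j then A (a ⟨i, hi⟩) (b ⟨i, hi⟩) else 0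
  else 1

/-- The two-site operator `u` placed at sites `i, i + 1` of the chain of `n` sites. -/
def gateOp {q : ℕ} (n i : ℕ) (u : Matrix (Fin q × Fin q) (Fin q × Fin q) ℂ) : Op q n :=
  if hi : i + 1 < n then
    Matrix.of fun a b =>
      if ∀ j : Fin n, (j : ℕ) ≠ i → (j : ℕ) ≠ i + 1 → a j = b j then
        u (a ⟨i, Nat.lt_of_succ_lt hi⟩, a ⟨i + 1, hi⟩)
          (b ⟨i, Nat.lt_of_succ_lt hi⟩, b ⟨i + 1, hi⟩)
      else 0
  else 1

/-! ### The brick-wall circuit and the out-of-time-order correlator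

The two local operators of the correlator have light cones that overlap in a rectangle with light-like
sides `w` and `τ`; it lives on `w + τ` sites and on `w + τ - 1` time layers. The gates outside this
rectangle cancel in the correlator by unitarity and are replaced by the identity. The gate with
light-like coordinates `(j, k)`, `j < τ`, `k < w`, belongs to the layer `s = j + k` and
acts on the sites `τ - 1 - j + k` and `τ - j + k`. -/

/-- One brick-wall time layer: the (commuting, pairwise disjoint) gates `(s - k, k)`. -/
def layer {q : ℕ} (w τ : ℕ) (g : Fin τ → Fin w → Gate q) (s : ℕ) : Op q (w + τ) :=
  ((List.finRange w).map fun k : Fin w =>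
    if h : (k : ℕ) ≤ s ∧ s - (k : ℕ) < τ then
      gateOp (w + τ) (τ - 1 - (s - (k : ℕ)) + (k : ℕ)) (g ⟨s - (k : ℕ), h.2⟩ k).1
    else 1).prod

/-- The evolution operator `U = Ũ(0) Ũ(1) ⋯ Ũ(w + τ - 2)`. -/
def evolution {q : ℕ} (w τ : ℕ) (g : Fin τ → Fin w → Gate q) : Op q (w + τ) :=
  ((List.range (w + τ - 1)).map (layer w τ g)).prod

/-- Infinite-temperature expectation value `tr X / q ^ n`. -/
def expval {q n : ℕ} (X : Op q n) : ℂ := Matrix.trace X / (q : ℂ) ^ n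

/-- Heisenberg operator `σ^μ(t) = U† σ^μ U`, where `σ^μ` starts at the site `τ`. -/
def heisenberg {q : ℕ} [NeZero q] (w τ : ℕ) (g : Fin τ → Fin w → Gate q)
    (μ : PauliIndex q) : Op q (w + τ) :=
  (evolution w τ g).conjTranspose * siteOp (w + τ) τ (pauli μ) * evolution w τ g

/-- `1 - ⟨σ^μ(t)† (σ^ν)† σ^μ(t) σ^ν⟩` for given gates. The operator `σ^ν` is at the
site `w - 1`; for `w = 1` it is exactly on the light cone of `σ^μ(t)`. -/
def gateOTOC {q : ℕ} [NeZero q] (w τ : ℕ) (g : Fin τ → Fin w → Gate q)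
    (μ ν : PauliIndex q) : ℂ :=
  1 - expval ((heisenberg w τ g μ).conjTranspose *
    (siteOp (w + τ) (w - 1) (pauli ν)).conjTranspose *
    heisenberg w τ g μ * siteOp (w + τ) (w - 1) (pauli ν))

variable {Ω : Type*} [MeasurableSpace Ω]

/-- The OTOC `C_{μν}(w, τ)`, averaged over independent gates that are all distributed as the random
gate `u`. If `u` is constant, this is the OTOC of the space-time invariant circuit. -/
def otoc {q : ℕ} [NeZero q] (P : Measure Ω) (u : Ω → Gate q) (w τ : ℕ)
    (μ ν : PauliIndex q) : ℂ :=
  ∫ ω : Fin τ → Fin w → Ω, gateOTOC w τ (fun j k => u (ω j k)) μ ν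
    ∂(Measure.pi fun _ : Fin τ => Measure.pi fun _ : Fin w => P)

/-! ### Light-like generators

A state of the replicated chain of `w` sites is an operator on two copies of the chain. In this
identification, `|0^w⟩` is `q^(-w/2)` times the identity, `|1^w⟩` is `q^(-w/2)` times the swap of the
two copies, and the inner product is the Hilbert–Schmidt one. -/

/-- Operators on two copies of a chain of `w` sites. -/
abbrev State (q w : ℕ) : Type :=
  Matrix (Config q w × Config q w) (Config q w × Config q w) ℂ

/-- The swap of the two copies. -/
def swapOp (q w : ℕ) : State q w :=
  Matrix.of fun a b => if a = b.swap then 1 else 0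

/-- `𝟙 ⊗ v`: a new site, carrying the identity on both copies, is added on the left. -/
def addLeft {q w : ℕ} (v : State q w) : State q (w + 1) :=
  Matrix.of fun a b =>
    if a.1 0 = b.1 0 ∧ a.2 0 = b.2 0 then
      v (Fin.tail a.1, Fin.tail a.2) (Fin.tail b.1, Fin.tail b.2)
    else 0

/-- `tr_{last site} (S V)`: both copies of the rightmost site are contracted with the swap. -/
def contractRight {q w : ℕ} (V : State q (w + 1)) : State q w :=
  Matrix.of fun a b =>
    ∑ x : Fin q, ∑ y : Fin q,
      V (Fin.snoc (α := fun _ => Fin q) a.1 x, Fin.snoc (α := fun _ => Fin q) a.2 y)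
        (Fin.snoc (α := fun _ => Fin q) b.1 y, Fin.snoc (α := fun _ => Fin q) b.2 x)

/-- The light-like row of gates `u_{0,1} u_{1,2} ⋯ u_{w-1,w}` on `w + 1` sites. -/
def staircase {q : ℕ} (w : ℕ) (g : Fin w → Gate q) : Op q (w + 1) :=
  ((List.finRange w).map fun k : Fin w => gateOp (w + 1) (k : ℕ) (g k).1).prod

/-- The light-like generator with given gates: with `Ũ = U ⊗ U`, `U` the staircase,
`v ↦ q⁻¹ tr_{last site} (S Ũ† (𝟙 ⊗ v) Ũ)`. The factor `q⁻¹` comes from the normalization `q^(-1/2)`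
of both the `|0⟩` on the left and the `⟨1|` on the right. -/
def gateLLG {q : ℕ} (w : ℕ) (g : Fin w → Gate q) (v : State q w) : State q w :=
  ((q : ℂ)⁻¹) • contractRight
    ((staircase w g ⊗ₖ staircase w g).conjTranspose * addLeft v *
      (staircase w g ⊗ₖ staircase w g))

/-- The light-like generator `T_w`: the average of `gateLLG` over independent gates distributed as `u`
(defined on matrix units and extended linearly). -/
def genT {q : ℕ} (P : Measure Ω) (u : Ω → Gate q) (w : ℕ) :
    Module.End ℂ (State q w) :=
  (Matrix.stdBasis ℂ (Config q w × Config q w) (Config q w × Config q w)).constr ℂ fun e =>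
    Matrix.of fun a b =>
      ∫ ω : Fin w → Ω, gateLLG w (fun k => u (ω k)) (Matrix.single e.1 e.2 1) a b
        ∂(Measure.pi fun _ : Fin w => P)

/-- The operator `|0^w⟩⟨1^w|`, that is `v ↦ q^(-w) tr (S v) 𝟙`. -/
def trivialPart (q w : ℕ) : Module.End ℂ (State q w) :=
  (((q : ℂ) ^ w)⁻¹ •
    (Matrix.traceLinearMap (Config q w × Config q w) ℂ ℂ).comp
      (LinearMap.mulLeft ℂ (swapOp q w))).smulRight 1

/-- The OTOC light-like generator `F_w = T_w - |0^w⟩⟨1^w|`. -/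
def genF {q : ℕ} (P : Measure Ω) (u : Ω → Gate q) (w : ℕ) : Module.End ℂ (State q w) :=
  genT P u w - trivialPart q w

/-- `z` is a leading eigenvalue of `f`: an eigenvalue of maximal modulus. -/
def IsLeadingEigenvalue {V : Type*} [AddCommGroup V] [Module ℂ V] (f : Module.End ℂ V)
    (z : ℂ) : Prop :=
  f.HasEigenvalue z ∧ ∀ z' : ℂ, f.HasEigenvalue z' → ‖z'‖ ≤ ‖z‖

/-- `φ = max (N_i - 1)` over the Jordan blocks, of size `N_i`, that belong to eigenvalues of maximal
modulus. (The generalized eigenspace index of `z` is the size of the largest Jordan block of `z`.) -/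
def jordanExponent {V : Type*} [AddCommGroup V] [Module ℂ V] (f : Module.End ℂ V) : ℕ :=
  sSup {n | ∃ z : ℂ, IsLeadingEigenvalue f z ∧ n = f.maxGenEigenspaceIndex z - 1}

/-- `liminf_{τ → ∞} Re C_{μν}(w, τ) / (τ^φ(w) |z|^τ) > 0`, where `z` is to be a leading
eigenvalue of `F_w`. -/
def LiminfCondition {q : ℕ} [NeZero q] (P : Measure Ω) (u : Ω → Gate q) (w : ℕ) (z : ℂ)
    (μ ν : PauliIndex q) : Prop :=
  0 < liminf (fun τ : ℕ =>
    (((otoc P u w τ μ ν).re / ((τ : ℝ) ^ jordanExponent (genF P u w) * ‖z‖ ^ τ) : ℝ) : EReal))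
    atTop

end

end LightLikeOTOC

/-!
A replicated operator `O† ⊗ O` evolves linearly. Everything below estimates linear functionals of
such states, in the order `FLe` that is dual to the cone generated by the states `O† ⊗ O`. The maps
in play (`genT`, the contraction of the last site, the projections to operators that are trivial or
traceless on the first site) are positive for this order.

*The circuit.* The brick-wall circuit equals the product of its light-like rows (`evolution_succ`),
and each row, once the rightmost site is contracted, acts as one light-like generator
(`swapTrace_evolution`). Averaging over independent rows gives `otoc = m (T_w ^ τ b)` for a
functional `m` that vanishes on the identity (`otoc_eq`), hence `otoc = m (F_w ^ τ b)`, and `|otoc|`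
grows at most like `r ^ τ` for all `r > |z₂ w|` (`norm_otoc_le`).

*Lower bound.* As `F_{w+1} (𝟙 ⊗ v) = 𝟙 ⊗ F_w v`, every eigenvalue of `F_1` is an eigenvalue of `F_w`
(`hasEigenvalue_genF_of_one`), so `|z₂ 1| ≤ |z₂ w|`.

*Upper bound.* The real part of the correlator is half the squared norm of a commutator, so it is at
most a multiple of the weight of the operators that are not trivial on all of the `w` sites
(`otocFunctional_fle`). This weight grows at most like `ρ ^ τ` for every `ρ > |z₂ 1|`
(`exists_tracelessWeight_le`), by induction on `w`: at every step the operator is split into the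
part that is traceless on the first site and the part that is trivial there. The second is an
operator on `w - 1` sites. The first stays on the light cone, and by unitarity the sites behind the
light cone can be contracted (`contractRight_gateLLG`), so that its weight is governed by `F_1`
(`exists_edgeStep_le_one`). The cross terms cost a factor `1 + δ` per step
(`fle_traceless_add_twirl`). The liminf condition bounds the real part below by a multiple of
`|z₂ w| ^ τ`, which leads to `|z₂ w| ≤ |z₂ 1|`. Without it the argument would fail, because `F_w`
also acts on states `A ⊗ B` with different operators in the two copies, which the weights do not
control.
-/

namespace LightLikeOTOC

/-! ### Adding sites to operators -/

/-- `𝟙 ⊗ A`: a new site is added on the left of the chain. -/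
noncomputable def addFirst {q n : ℕ} : Op q n →ₐ[ℂ] Op q (n + 1) :=
  AlgHom.ofLinearMap
    { toFun := fun A => Matrix.of fun a b => if a 0 = b 0 then A (Fin.tail a) (Fin.tail b) else 0
      map_add' := fun A B => by
        ext a b; simp only [Matrix.of_apply, Matrix.add_apply]; split <;> simp
      map_smul' := fun c A => by
        ext a b; simp only [Matrix.of_apply, Matrix.smul_apply, RingHom.id_apply]; split <;> simp }
    (by
      ext a b
      simp only [LinearMap.coe_mk, AddHom.coe_mk, Matrix.of_apply, Matrix.one_apply]
      rw [← ite_and]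
      refine if_congr ?_ rfl rfl
      conv_rhs => rw [← Fin.cons_self_tail a, ← Fin.cons_self_tail b, Fin.cons_inj])
    (fun A B => by
      ext a b
      simp only [LinearMap.coe_mk, AddHom.coe_mk, Matrix.of_apply, Matrix.mul_apply]
      rw [← (Fin.consEquiv fun _ => Fin q).sum_comp, Fintype.sum_prod_type_right]
      by_cases h : a 0 = b 0 <;> simp [Fin.consEquiv, ite_mul, mul_ite, h])

/-- `A ⊗ 𝟙`: a new site is added on the right of the chain. -/
noncomputable def addLast {q n : ℕ} : Op q n →ₐ[ℂ] Op q (n + 1) :=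
  AlgHom.ofLinearMap
    { toFun := fun A => Matrix.of fun a b =>
        if a (Fin.last n) = b (Fin.last n) then A (Fin.init a) (Fin.init b) else 0
      map_add' := fun A B => by
        ext a b; simp only [Matrix.of_apply, Matrix.add_apply]; split <;> simp
      map_smul' := fun c A => by
        ext a b; simp only [Matrix.of_apply, Matrix.smul_apply, RingHom.id_apply]; split <;> simp }
    (by
      ext a b
      simp only [LinearMap.coe_mk, AddHom.coe_mk, Matrix.of_apply, Matrix.one_apply]
      rw [← ite_and]
      refine if_congr ?_ rfl rfl
      conv_rhs => rw [← Fin.snoc_init_self a, ← Fin.snoc_init_self b, Fin.snoc_inj]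
      exact and_comm)
    (fun A B => by
      ext a b
      simp only [LinearMap.coe_mk, AddHom.coe_mk, Matrix.of_apply, Matrix.mul_apply]
      rw [← (Fin.snocEquiv fun _ => Fin q).sum_comp, Fintype.sum_prod_type_right]
      by_cases h : a (Fin.last n) = b (Fin.last n) <;>
        simp [Fin.snocEquiv, ite_mul, mul_ite, h])

theorem addFirst_apply {q n : ℕ} (A : Op q n) (a b : Config q (n + 1)) :
    addFirst A a b = if a 0 = b 0 then A (Fin.tail a) (Fin.tail b) else 0 := rfl

theorem addLast_apply {q n : ℕ} (A : Op q n) (a b : Config q (n + 1)) :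
    addLast A a b =
      if a (Fin.last n) = b (Fin.last n) then A (Fin.init a) (Fin.init b) else 0 := rfl

theorem addFirst_conjTranspose {q n : ℕ} (A : Op q n) :
    addFirst A.conjTranspose = (addFirst A).conjTranspose := by
  ext a b
  simp only [addFirst_apply, Matrix.conjTranspose_apply, eq_comm (a := b 0)]
  split <;> simp

theorem addLast_conjTranspose {q n : ℕ} (A : Op q n) :
    addLast A.conjTranspose = (addLast A).conjTranspose := by
  ext a b
  simp only [addLast_apply, Matrix.conjTranspose_apply, eq_comm (a := b (Fin.last n))]
  split <;> simp

/-- The matrix element `⟨x| A |y⟩` with respect to the rightmost site. -/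
def lastBlock {q n : ℕ} (x y : Fin q) (A : Op q (n + 1)) : Op q n :=
  A.submatrix (fun a => Fin.snoc (α := fun _ => Fin q) a x)
    (fun b => Fin.snoc (α := fun _ => Fin q) b y)

theorem lastBlock_addLast_mul {q n : ℕ} (x y : Fin q) (C : Op q n) (A : Op q (n + 1)) :
    lastBlock x y (addLast C * A) = C * lastBlock x y A := by
  ext a b
  simp only [lastBlock, Matrix.submatrix_apply, Matrix.mul_apply, addLast_apply]
  rw [← (Fin.snocEquiv fun _ => Fin q).sum_comp, Fintype.sum_prod_type_right]
  simp [Fin.snocEquiv, ite_mul]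

theorem lastBlock_mul_addLast {q n : ℕ} (x y : Fin q) (C : Op q n) (A : Op q (n + 1)) :
    lastBlock x y (A * addLast C) = lastBlock x y A * C := by
  ext a b
  simp only [lastBlock, Matrix.submatrix_apply, Matrix.mul_apply, addLast_apply]
  rw [← (Fin.snocEquiv fun _ => Fin q).sum_comp, Fintype.sum_prod_type_right]
  simp [Fin.snocEquiv, mul_ite]

theorem lastBlock_one {q n : ℕ} (x y : Fin q) :
    lastBlock x y (1 : Op q (n + 1)) = if x = y then 1 else 0 := by
  ext a b
  by_cases hxy : x = y
  · simp [lastBlock, Matrix.one_apply, hxy, Fin.snoc_inj]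
  · simp [lastBlock, hxy, Fin.snoc_inj]

theorem sum_trace_lastBlock_mul {q n : ℕ} (A B : Op q (n + 1)) :
    ∑ x, ∑ y, (lastBlock x y A * lastBlock y x B).trace = (A * B).trace := by
  simp only [Matrix.trace, Matrix.diag_apply, Matrix.mul_apply, lastBlock, Matrix.submatrix_apply]
  rw [← (Fin.snocEquiv fun _ => Fin q).sum_comp, Fintype.sum_prod_type]
  refine Finset.sum_congr rfl fun x _ => ?_
  rw [Finset.sum_comm]
  refine Finset.sum_congr rfl fun a _ => ?_
  rw [← (Fin.snocEquiv fun _ => Fin q).sum_comp, Fintype.sum_prod_type]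
  rfl

theorem lastBlock_addFirst {q n : ℕ} (x y : Fin q) (A : Op q (n + 1)) :
    lastBlock x y (addFirst A) = addFirst (lastBlock x y A) := by
  have key : ∀ (c : Config q (n + 1)) (x : Fin q),
      Fin.tail (Fin.snoc (α := fun _ => Fin q) c x) =
        Fin.snoc (α := fun _ => Fin q) (Fin.tail c) x := by
    intro c x
    conv_lhs => rw [← Fin.cons_self_tail c]
    rw [← Fin.cons_snoc_eq_snoc_cons (β := Fin q)]
    rfl
  ext a b
  have h0 : ∀ (c : Config q (n + 1)) (x : Fin q),
      (Fin.snoc (α := fun _ => Fin q) c x : Config q (n + 2)) 0 = c 0 := by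
    intro c x
    exact Fin.snoc_castSucc (α := fun _ => Fin q) (n := n + 1) x c 0
  simp only [lastBlock, Matrix.submatrix_apply, addFirst_apply, key, h0]

theorem trace_addFirst {q n : ℕ} (A : Op q n) : (addFirst A).trace = q * A.trace := by
  simp only [Matrix.trace, Matrix.diag_apply, addFirst_apply]
  rw [← (Fin.consEquiv fun _ => Fin q).sum_comp, Fintype.sum_prod_type]
  simp [Fin.consEquiv]

/-- The partial trace over the leftmost site. -/
noncomputable def traceFirst {q n : ℕ} : Op q (n + 1) →ₗ[ℂ] Op q n where
  toFun A := ∑ x : Fin q, A.submatrix (fun a => Fin.cons (α := fun _ => Fin q) x a)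
    (fun b => Fin.cons (α := fun _ => Fin q) x b)
  map_add' A B := by simp [Matrix.submatrix_add, Finset.sum_add_distrib]
  map_smul' c A := by simp [Matrix.submatrix_smul, Finset.smul_sum]

theorem traceFirst_apply {q n : ℕ} (A : Op q (n + 1)) (a b : Config q n) :
    traceFirst A a b = ∑ x : Fin q, A (Fin.cons (α := fun _ => Fin q) x a)
      (Fin.cons (α := fun _ => Fin q) x b) := by
  exact Matrix.sum_apply a b Finset.univ fun x : Fin q =>
    A.submatrix (fun a => Fin.cons (α := fun _ => Fin q) x a)
      (fun b => Fin.cons (α := fun _ => Fin q) x b)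

theorem traceFirst_addFirst {q n : ℕ} (A : Op q n) : traceFirst (addFirst A) = (q : ℂ) • A := by
  ext a b
  simp [traceFirst_apply, addFirst_apply]

theorem traceFirst_conjTranspose {q n : ℕ} (A : Op q (n + 1)) :
    traceFirst A.conjTranspose = (traceFirst A).conjTranspose := by
  ext a b
  simp [traceFirst_apply]

theorem traceFirst_addFirst_mul {q n : ℕ} (C : Op q n) (A : Op q (n + 1)) :
    traceFirst (addFirst C * A) = C * traceFirst A := by
  ext a b
  simp only [traceFirst_apply, Matrix.mul_apply, addFirst_apply, Finset.mul_sum]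
  refine Eq.trans (Finset.sum_congr rfl fun x _ => ?_) Finset.sum_comm
  rw [← (Fin.consEquiv fun _ => Fin q).sum_comp, Fintype.sum_prod_type_right]
  simp [Fin.consEquiv, ite_mul]

theorem trace_traceFirst {q n : ℕ} (A : Op q (n + 1)) : (traceFirst A).trace = A.trace := by
  simp only [Matrix.trace, Matrix.diag_apply, traceFirst_apply]
  rw [← (Fin.consEquiv fun _ => Fin q).sum_comp, Fintype.sum_prod_type, Finset.sum_comm]
  rfl

theorem traceFirst_lastBlock {q n : ℕ} (x y : Fin q) (A : Op q (n + 2)) :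
    traceFirst (lastBlock x y A) = lastBlock x y (traceFirst A) := by
  ext a b
  simp only [traceFirst_apply, lastBlock, Matrix.submatrix_apply]
  refine Finset.sum_congr rfl fun z _ => ?_
  rw [← Fin.cons_snoc_eq_snoc_cons (β := Fin q), ← Fin.cons_snoc_eq_snoc_cons (β := Fin q)]

/-- An operator on a chain of no sites is a number. -/
theorem op_zero_eq_smul_one {q : ℕ} (A : Op q 0) : A = A default default • (1 : Op q 0) := by
  ext a b
  rw [Subsingleton.elim a default, Subsingleton.elim b default]
  simp

/-! ### Gates and one-site operators on longer chains -/

theorem gateOp_succ_succ {q : ℕ} (n i : ℕ) (u : Matrix (Fin q × Fin q) (Fin q × Fin q) ℂ) :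
    gateOp (n + 1) (i + 1) u = addFirst (gateOp n i u) := by
  by_cases h : i + 1 < n
  · ext a b
    rw [addFirst_apply, gateOp, gateOp, dif_pos (by omega), dif_pos h]
    simp only [Matrix.of_apply, Fin.forall_fin_succ, Fin.val_succ, ne_eq, Nat.add_right_cancel_iff]
    rw [← ite_and]
    refine if_congr ?_ rfl rfl
    simp [Fin.tail]
  · rw [gateOp, gateOp, dif_neg (by omega), dif_neg h, map_one]

theorem gateOp_succ {q : ℕ} (n i : ℕ) (hi : i + 1 < n)
    (u : Matrix (Fin q × Fin q) (Fin q × Fin q) ℂ) :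
    gateOp (n + 1) i u = addLast (gateOp n i u) := by
  ext a b
  rw [addLast_apply, gateOp, gateOp, dif_pos (by omega), dif_pos hi]
  simp only [Matrix.of_apply, Fin.forall_fin_succ', Fin.val_castSucc, Fin.val_last, ne_eq]
  rw [← ite_and]
  refine if_congr ?_ rfl rfl
  simp only [Fin.init, show n ≠ i by omega, show n ≠ i + 1 by omega, not_false_eq_true,
    true_imp_iff]
  exact and_comm

theorem siteOp_succ_succ {q : ℕ} (n i : ℕ) (A : Matrix (Fin q) (Fin q) ℂ) :
    siteOp (n + 1) (i + 1) A = addFirst (siteOp n i A) := by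
  by_cases h : i < n
  · ext a b
    rw [addFirst_apply, siteOp, siteOp, dif_pos (by omega), dif_pos h]
    simp only [Matrix.of_apply, Fin.forall_fin_succ, Fin.val_succ, ne_eq, Nat.add_right_cancel_iff]
    rw [← ite_and]
    refine if_congr ?_ rfl rfl
    simp [Fin.tail]
  · rw [siteOp, siteOp, dif_neg (by omega), dif_neg h, map_one]

theorem siteOp_succ {q : ℕ} (n i : ℕ) (hi : i < n) (A : Matrix (Fin q) (Fin q) ℂ) :
    siteOp (n + 1) i A = addLast (siteOp n i A) := by
  ext a b
  rw [addLast_apply, siteOp, siteOp, dif_pos (by omega), dif_pos hi]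
  simp only [Matrix.of_apply, Fin.forall_fin_succ', Fin.val_castSucc, Fin.val_last, ne_eq]
  rw [← ite_and]
  refine if_congr ?_ rfl rfl
  simp only [Fin.init, show n ≠ i by omega, not_false_eq_true, true_imp_iff]
  exact and_comm

/-! ### Operators with disjoint supports commute -/

/-- `A` acts on the sites in `s` only, that is `A = A' ⊗ 𝟙`, with `𝟙` on the sites outside `s`. -/
def LocalOn {q n : ℕ} (s : Finset (Fin n)) (A : Op q n) : Prop :=
  (∀ a b, (∃ j, j ∉ s ∧ a j ≠ b j) → A a b = 0) ∧
  ∀ a b a' b', (∀ j ∈ s, a j = a' j ∧ b j = b' j) → (∀ j, j ∉ s → a j = b j ∧ a' j = b' j) →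
    A a b = A a' b'

theorem LocalOn.mul_apply {q n : ℕ} {s t : Finset (Fin n)} {A B : Op q n} (hA : LocalOn s A)
    (hB : LocalOn t B) (hst : Disjoint s t) (a b : Config q n) :
    (A * B) a b = A a (s.piecewise b a) * B (s.piecewise b a) b := by
  rw [Matrix.mul_apply]
  refine Finset.sum_eq_single _ (fun c _ hc => ?_) (by simp)
  obtain ⟨j, hj⟩ := Function.ne_iff.1 hc
  by_cases hjs : j ∈ s
  · rw [Finset.piecewise_eq_of_mem _ _ _ hjs] at hj
    rw [hB.1 c b ⟨j, Finset.disjoint_left.1 hst hjs, hj⟩, mul_zero]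
  · rw [Finset.piecewise_eq_of_notMem _ _ _ hjs] at hj
    rw [hA.1 a c ⟨j, hjs, Ne.symm hj⟩, zero_mul]

theorem LocalOn.commute {q n : ℕ} {s t : Finset (Fin n)} {A B : Op q n} (hA : LocalOn s A)
    (hB : LocalOn t B) (hst : Disjoint s t) : Commute A B := by
  ext a b
  rw [hA.mul_apply hB hst, hB.mul_apply hA hst.symm]
  by_cases h : ∃ j, j ∉ s ∧ j ∉ t ∧ a j ≠ b j
  · obtain ⟨j, hs, ht, hab⟩ := h
    rw [hB.1 (s.piecewise b a) b ⟨j, ht, by rwa [Finset.piecewise_eq_of_notMem _ _ _ hs]⟩,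
      hA.1 (t.piecewise b a) b ⟨j, hs, by rwa [Finset.piecewise_eq_of_notMem _ _ _ ht]⟩]
    simp
  · push Not at h
    rw [mul_comm]
    congr 1
    · refine hB.2 _ _ _ _ (fun j hj => ?_) fun j hj => ?_
      · simp [hj, Finset.disjoint_right.1 hst hj]
      · by_cases hs : j ∈ s <;> simp [hj, hs, h]
    · refine hA.2 _ _ _ _ (fun j hj => ?_) fun j hj => ?_
      · simp [hj, Finset.disjoint_left.1 hst hj]
      · by_cases ht : j ∈ t <;> simp [hj, ht, h]

theorem localOn_of_forall_mem {q n : ℕ} {s : Finset (Fin n)} (hs : ∀ j, j ∈ s) (A : Op q n) :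
    LocalOn s A := by
  refine ⟨fun a b ⟨j, hj, _⟩ => absurd (hs j) hj, fun a b a' b' h _ => ?_⟩
  rw [show a = a' from funext fun j => (h j (hs j)).1,
    show b = b' from funext fun j => (h j (hs j)).2]

theorem localOn_one {q n : ℕ} (s : Finset (Fin n)) : LocalOn s (1 : Op q n) := by
  refine ⟨fun a b ⟨j, _, hj⟩ => Matrix.one_apply_ne fun h => hj (by rw [h]),
    fun a b a' b' h h' => ?_⟩
  rw [Matrix.one_apply, Matrix.one_apply]
  refine if_congr ⟨fun e => ?_, fun e => ?_⟩ rfl rfl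
  · ext j; by_cases hj : j ∈ s
    · rw [← (h j hj).1, ← (h j hj).2, e]
    · rw [(h' j hj).2]
  · ext j; by_cases hj : j ∈ s
    · rw [(h j hj).1, (h j hj).2, e]
    · rw [(h' j hj).1]

theorem localOn_gateOp {q n i : ℕ} (u : Matrix (Fin q × Fin q) (Fin q × Fin q) ℂ) :
    LocalOn (Finset.univ.filter fun j : Fin n => (j : ℕ) = i ∨ (j : ℕ) = i + 1)
      (gateOp n i u) := by
  unfold gateOp
  split_ifs with hi
  · refine ⟨fun a b ⟨j, hj, hab⟩ => ?_, fun a b a' b' h h' => ?_⟩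
    · simp only [Finset.mem_filter, Finset.mem_univ, true_and, not_or] at hj
      exact if_neg fun H => hab (H j hj.1 hj.2)
    · have h1 := h ⟨i, by omega⟩ (by simp)
      have h2 := h ⟨i + 1, hi⟩ (by simp)
      simp only [Matrix.of_apply, h1, h2]
      refine if_congr ⟨fun _ j hj hj' => (h' j ?_).2, fun _ j hj hj' => (h' j ?_).1⟩ rfl rfl <;>
      simp [hj, hj']
  · exact localOn_one _

theorem commute_gateOp {q n i j : ℕ} (hij : i + 2 ≤ j)
    (u v : Matrix (Fin q × Fin q) (Fin q × Fin q) ℂ) :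
    Commute (gateOp n i u) (gateOp n j v) :=
  (localOn_gateOp u).commute (localOn_gateOp v) <| by
    rw [Finset.disjoint_left]
    intro k
    simp only [Finset.mem_filter, Finset.mem_univ, true_and]
    omega

theorem LocalOn.addLast {q n k : ℕ} {A : Op q n} (hk : k ≤ n)
    (hA : LocalOn (Finset.univ.filter fun j : Fin n => (j : ℕ) < k) A) :
    LocalOn (Finset.univ.filter fun j : Fin (n + 1) => (j : ℕ) < k) (addLast A) := by
  refine ⟨fun a b ⟨j, hj, hab⟩ => ?_, fun a b a' b' h h' => ?_⟩
  · rw [addLast_apply]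
    split_ifs with hl
    · induction j using Fin.lastCases with
      | last => exact absurd hl hab
      | cast j => exact hA.1 _ _ ⟨j, by simpa using hj, hab⟩
    · rfl
  · rw [addLast_apply, addLast_apply]
    have hl := h' (Fin.last n) (by simpa using hk)
    rw [if_pos hl.1, if_pos hl.2]
    exact hA.2 _ _ _ _ (fun j hj => h j.castSucc (by simpa using hj))
      fun j hj => h' j.castSucc (by simpa using hj)

/-- Operators on the first `n` of `n + 2` sites commute with the gates on the last two sites. -/
theorem commute_addLast_addLast_gateOp {q n : ℕ} (A : Op q n)
    (u : Matrix (Fin q × Fin q) (Fin q × Fin q) ℂ) :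
    Commute (addLast (addLast A)) (gateOp (n + 2) n u) := by
  have hA : LocalOn (Finset.univ.filter fun j : Fin n => (j : ℕ) < n) A :=
    localOn_of_forall_mem (by simp) A
  refine ((hA.addLast le_rfl).addLast (Nat.le_succ n)).commute (localOn_gateOp u) ?_
  rw [Finset.disjoint_left]
  intro k
  simp only [Finset.mem_filter, Finset.mem_univ, true_and]
  omega

theorem LocalOn.addFirst {q n k : ℕ} {A : Op q n}
    (hA : LocalOn (Finset.univ.filter fun j : Fin n => k ≤ (j : ℕ)) A) :
    LocalOn (Finset.univ.filter fun j : Fin (n + 1) => k + 1 ≤ (j : ℕ)) (addFirst A) := by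
  refine ⟨fun a b ⟨j, hj, hab⟩ => ?_, fun a b a' b' h h' => ?_⟩
  · rw [addFirst_apply]
    split_ifs with hl
    · induction j using Fin.cases with
      | zero => exact absurd hl hab
      | succ j => exact hA.1 _ _ ⟨j, by simpa using hj, hab⟩
    · rfl
  · rw [addFirst_apply, addFirst_apply]
    have hl := h' 0 (by simp)
    rw [if_pos hl.1, if_pos hl.2]
    exact hA.2 _ _ _ _ (fun j hj => h j.succ (by simpa using hj))
      fun j hj => h' j.succ (by simpa using hj)

/-- Operators on the last `n` of `n + 2` sites commute with the gates on the first two sites. -/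
theorem commute_addFirst_addFirst_gateOp {q n : ℕ} (A : Op q n)
    (u : Matrix (Fin q × Fin q) (Fin q × Fin q) ℂ) :
    Commute (addFirst (addFirst A)) (gateOp (n + 2) 0 u) := by
  have hA : LocalOn (Finset.univ.filter fun j : Fin n => 0 ≤ (j : ℕ)) A :=
    localOn_of_forall_mem (by simp) A
  refine hA.addFirst.addFirst.commute (localOn_gateOp u) ?_
  rw [Finset.disjoint_left]
  intro k
  simp only [Finset.mem_filter, Finset.mem_univ, true_and]
  omega

/-! ### Product states -/

/-- Linear maps on states are determined by their values on product states `A ⊗ B`. -/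
theorem hom_ext_kron {q n : ℕ} {M : Type*} [AddCommMonoid M] [Module ℂ M]
    {f g : State q n →ₗ[ℂ] M} (h : ∀ A B : Op q n, f (A ⊗ₖ B) = g (A ⊗ₖ B)) : f = g := by
  refine (Matrix.stdBasis ℂ _ _).ext fun e => ?_
  have := h (Matrix.single e.1.1 e.2.1 1) (Matrix.single e.1.2 e.2.2 1)
  rw [Matrix.single_kronecker_single, mul_one] at this
  obtain ⟨⟨a, b⟩, ⟨c, d⟩⟩ := e
  rwa [Matrix.stdBasis_eq_single]

/-- The linear map `f ⊗ g` on states. -/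
noncomputable def tensorMap {q n m : ℕ} (f g : Op q n →ₗ[ℂ] Op q m) :
    State q n →ₗ[ℂ] State q m :=
  (Matrix.stdBasis ℂ (Config q n × Config q n) (Config q n × Config q n)).constr ℂ fun e =>
    f (Matrix.single e.1.1 e.2.1 1) ⊗ₖ g (Matrix.single e.1.2 e.2.2 1)

theorem tensorMap_kron {q n m : ℕ} (f g : Op q n →ₗ[ℂ] Op q m) (A B : Op q n) :
    tensorMap f g (A ⊗ₖ B) = f A ⊗ₖ g B := by
  let κ (n : ℕ) : Op q n →ₗ[ℂ] Op q n →ₗ[ℂ] State q n := Matrix.kroneckerBilinear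
  have hκ : ∀ (n : ℕ) (A B : Op q n), κ n A B = A ⊗ₖ B := fun _ _ _ => rfl
  have key : (κ n).compr₂ (tensorMap f g) = (κ m).compl₁₂ f g := by
    refine (Matrix.stdBasis ℂ _ _).ext fun e => (Matrix.stdBasis ℂ _ _).ext fun e' => ?_
    obtain ⟨a, b⟩ := e
    obtain ⟨a', b'⟩ := e'
    rw [LinearMap.compr₂_apply, LinearMap.compl₁₂_apply, hκ, hκ, Matrix.stdBasis_eq_single,
      Matrix.stdBasis_eq_single, Matrix.single_kronecker_single, mul_one, tensorMap,
      ← Matrix.stdBasis_eq_single ℂ (a, a') (b, b'), Module.Basis.constr_basis]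
  exact LinearMap.congr_fun (LinearMap.congr_fun key A) B

/-- The adjunction of a site with the identity on both copies, as a linear map. -/
def addLeftLin {q n : ℕ} : State q n →ₗ[ℂ] State q (n + 1) where
  toFun := addLeft
  map_add' v w := by ext a b; simp only [addLeft, Matrix.of_apply, Matrix.add_apply]; split <;> simp
  map_smul' c v := by
    ext a b; simp only [addLeft, Matrix.of_apply, Matrix.smul_apply, RingHom.id_apply]
    split <;> simp

theorem addLeftLin_apply {q n : ℕ} (v : State q n) : addLeftLin v = addLeft v := rfl

/-- The contraction of the last site with the swap, as a linear map. -/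
def contractLin {q n : ℕ} : State q (n + 1) →ₗ[ℂ] State q n where
  toFun := contractRight
  map_add' v w := by
    ext a b; simp [contractRight, Finset.sum_add_distrib]
  map_smul' c v := by
    ext a b; simp [contractRight, Finset.mul_sum]

theorem contractLin_apply {q n : ℕ} (v : State q (n + 1)) : contractLin v = contractRight v := rfl

/-- The functional `v ↦ tr (S v)`, with `S` the swap of the two copies. -/
noncomputable def swapTrace (q n : ℕ) : State q n →ₗ[ℂ] ℂ :=
  (Matrix.traceLinearMap (Config q n × Config q n) ℂ ℂ).comp
    (LinearMap.mulLeft ℂ (swapOp q n))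

theorem swapTrace_eq_sum {q n : ℕ} (v : State q n) :
    swapTrace q n v = ∑ a, ∑ b, v (a, b) (b, a) := by
  simp only [swapTrace, LinearMap.comp_apply, LinearMap.mulLeft_apply, Matrix.traceLinearMap_apply,
    Matrix.trace, Matrix.diag_apply, Matrix.mul_apply, swapOp, Matrix.of_apply,
    Fintype.sum_prod_type, Prod.swap_prod_mk, Prod.mk.injEq, ite_mul, one_mul, zero_mul]
  rw [Finset.sum_comm]
  refine Finset.sum_congr rfl fun a _ => Finset.sum_congr rfl fun b _ => ?_
  rw [Finset.sum_eq_single a, Finset.sum_eq_single b] <;> simp +contextual [eq_comm]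

theorem swapTrace_kron {q n : ℕ} (A B : Op q n) : swapTrace q n (A ⊗ₖ B) = (A * B).trace := by
  rw [swapTrace_eq_sum]
  rfl

theorem addLeft_kron {q n : ℕ} (A B : Op q n) : addLeft (A ⊗ₖ B) = addFirst A ⊗ₖ addFirst B := by
  ext a b
  simp only [addLeft, Matrix.of_apply, Matrix.kroneckerMap_apply, addFirst_apply]
  by_cases h1 : a.1 0 = b.1 0 <;> by_cases h2 : a.2 0 = b.2 0 <;> simp [h1, h2]

theorem contractRight_kron {q n : ℕ} (A B : Op q (n + 1)) :
    contractRight (A ⊗ₖ B) = ∑ x, ∑ y, lastBlock x y A ⊗ₖ lastBlock y x B := by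
  ext a b
  simp [contractRight, lastBlock, Matrix.sum_apply]

theorem swapTrace_contractRight {q n : ℕ} (v : State q (n + 1)) :
    swapTrace q n (contractRight v) = swapTrace q (n + 1) v := by
  have : (swapTrace q n).comp contractLin = swapTrace q (n + 1) := hom_ext_kron fun A B => by
    simp [contractLin_apply, contractRight_kron, swapTrace_kron, sum_trace_lastBlock_mul]
  exact LinearMap.congr_fun this v

theorem swapTrace_addLeft {q n : ℕ} (v : State q n) :
    swapTrace q (n + 1) (addLeft v) = q * swapTrace q n v := by
  have : (swapTrace q (n + 1)).comp addLeftLin = (q : ℂ) • swapTrace q n :=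
    hom_ext_kron fun A B => by
      simp [addLeftLin_apply, addLeft_kron, swapTrace_kron, ← map_mul, trace_addFirst]
  exact LinearMap.congr_fun this v

theorem trace_addLeft {q n : ℕ} (v : State q n) :
    (addLeft v).trace = (q : ℂ) ^ 2 * v.trace := by
  have : (Matrix.traceLinearMap (Config q (n + 1) × Config q (n + 1)) ℂ ℂ).comp addLeftLin =
      (q : ℂ) ^ 2 • Matrix.traceLinearMap (Config q n × Config q n) ℂ ℂ :=
    hom_ext_kron fun A B => by
      simp only [LinearMap.comp_apply, addLeftLin_apply, addLeft_kron, Matrix.traceLinearMap_apply,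
        Matrix.trace_kronecker, trace_addFirst, LinearMap.smul_apply, smul_eq_mul]
      ring
  exact LinearMap.congr_fun this v

theorem contractRight_mul_addLast {q n : ℕ} (C D C' D' : Op q n) (v : State q (n + 1)) :
    contractRight ((addLast C ⊗ₖ addLast D) * v * (addLast C' ⊗ₖ addLast D')) =
      (C ⊗ₖ D) * contractRight v * (C' ⊗ₖ D') := by
  have : contractLin.comp ((LinearMap.mulRight ℂ (addLast C' ⊗ₖ addLast D')).comp
      (LinearMap.mulLeft ℂ (addLast C ⊗ₖ addLast D))) =
      ((LinearMap.mulRight ℂ (C' ⊗ₖ D')).comp (LinearMap.mulLeft ℂ (C ⊗ₖ D))).comp contractLin :=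
    hom_ext_kron fun A B => by
      simp only [LinearMap.comp_apply, LinearMap.mulRight_apply, LinearMap.mulLeft_apply,
        contractLin_apply, ← Matrix.mul_kronecker_mul, contractRight_kron, Matrix.mul_sum,
        Matrix.sum_mul, lastBlock_mul_addLast, lastBlock_addLast_mul]
  exact LinearMap.congr_fun this v

theorem contractRight_addLeft {q n : ℕ} (v : State q (n + 1)) :
    contractRight (addLeft v) = addLeft (contractRight v) := by
  have : contractLin.comp addLeftLin = (addLeftLin (q := q) (n := n)).comp contractLin :=
    hom_ext_kron fun A B => by
      simp only [LinearMap.comp_apply, addLeftLin_apply, addLeft_kron, contractLin_apply,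
        contractRight_kron, lastBlock_addFirst]
      simp only [← addLeftLin_apply, map_sum]
      simp only [addLeftLin_apply, addLeft_kron]
  exact LinearMap.congr_fun this v

theorem swapOp_mul_self (q n : ℕ) : swapOp q n * swapOp q n = 1 := by
  ext a b
  simp only [swapOp, Matrix.mul_apply, Matrix.of_apply, Matrix.one_apply]
  rw [Finset.sum_eq_single b.swap] <;> simp +contextual

/-- The pairing `(Z, v) ↦ tr (S Z v)` is nondegenerate, already for product operators `Z`. -/
theorem eq_of_swapTrace_kron_mul {q n : ℕ} {v v' : State q n}
    (h : ∀ C D : Op q n, swapTrace q n ((C ⊗ₖ D) * v) = swapTrace q n ((C ⊗ₖ D) * v')) :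
    v = v' := by
  have key : (swapTrace q n).comp (LinearMap.mulRight ℂ v) =
      (swapTrace q n).comp (LinearMap.mulRight ℂ v') := hom_ext_kron h
  refine Matrix.ext_iff_trace_mul_left.2 fun Z => ?_
  have := LinearMap.congr_fun key (swapOp q n * Z)
  simpa [swapTrace, ← mul_assoc, swapOp_mul_self] using this

/-! ### The light-like row of gates -/

/-- Placing a gate on a chain is a homomorphism of `*`-algebras. -/
theorem exists_algHom_gateOp (q n i : ℕ) (hi : i + 1 < n) :
    ∃ φ : Matrix (Fin q × Fin q) (Fin q × Fin q) ℂ →ₐ[ℂ] Op q n,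
      ∀ u, gateOp n i u = φ u ∧ φ u.conjTranspose = (φ u).conjTranspose := by
  induction n generalizing i with
  | zero => omega
  | succ n ih =>
    rcases i with _ | i
    · rcases Nat.lt_or_ge 1 n with hn | hn
      · obtain ⟨φ, h⟩ := ih 0 hn
        refine ⟨addLast.comp φ, fun u => ⟨?_, ?_⟩⟩
        · rw [gateOp_succ n 0 hn, (h u).1]; rfl
        · simp [(h u).2, addLast_conjTranspose]
      · obtain rfl : n = 1 := by omega
        refine ⟨(Matrix.reindexAlgEquiv ℂ ℂ (finTwoArrowEquiv (Fin q)).symm).toAlgHom,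
          fun u => ⟨?_, rfl⟩⟩
        ext a b
        simp [gateOp, Fin.forall_fin_succ, finTwoArrowEquiv]
    · obtain ⟨φ, h⟩ := ih i (by omega)
      refine ⟨addFirst.comp φ, fun u => ⟨?_, ?_⟩⟩
      · rw [gateOp_succ_succ, (h u).1]; rfl
      · simp [(h u).2, addFirst_conjTranspose]

theorem gateOp_mem_unitary {q : ℕ} (n i : ℕ) (u : Gate q) :
    gateOp n i u.1 ∈ Matrix.unitaryGroup (Config q n) ℂ := by
  by_cases hi : i + 1 < n
  · obtain ⟨φ, h⟩ := exists_algHom_gateOp q n i hi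
    rw [Matrix.mem_unitaryGroup_iff, (h u.1).1, Matrix.star_eq_conjTranspose, ← (h u.1).2,
      ← map_mul, ← Matrix.star_eq_conjTranspose, Matrix.mem_unitaryGroup_iff.1 u.2, map_one]
  · rw [gateOp, dif_neg hi]
    exact one_mem _

theorem staircase_mem_unitary {q : ℕ} (w : ℕ) (g : Fin w → Gate q) :
    staircase w g ∈ Matrix.unitaryGroup (Config q (w + 1)) ℂ :=
  Submonoid.list_prod_mem _ fun x hx => by
    obtain ⟨k, -, rfl⟩ := List.mem_map.1 hx
    exact gateOp_mem_unitary _ _ _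

theorem staircase_succ_last {q : ℕ} (w : ℕ) (g : Fin (w + 1) → Gate q) :
    staircase (w + 1) g =
      addLast (staircase w fun k => g k.castSucc) * gateOp (w + 2) w (g (Fin.last w)).1 := by
  rw [staircase, staircase, List.finRange_succ_last, List.map_append, List.prod_append,
    List.map_map, map_list_prod, List.map_map]
  congr 1
  · congr 1
    refine List.map_congr_left fun k _ => ?_
    exact gateOp_succ (w + 1) k (by omega) _
  · simp

theorem staircase_succ {q : ℕ} (w : ℕ) (g : Fin (w + 1) → Gate q) :
    staircase (w + 1) g =
      gateOp (w + 2) 0 (g 0).1 * addFirst (staircase w fun k => g k.succ) := by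
  rw [staircase, staircase, List.finRange_succ, List.map_cons, List.prod_cons, List.map_map,
    map_list_prod, List.map_map]
  congr 2
  refine List.map_congr_left fun k _ => ?_
  simp [gateOp_succ_succ]

/-- The Heisenberg evolution `A ↦ V† (𝟙 ⊗ A) V` by the light-like row of gates `V`. -/
noncomputable def rowEvolve {q : ℕ} (w : ℕ) (g : Fin w → Gate q) (A : Op q w) : Op q (w + 1) :=
  (staircase w g).conjTranspose * addFirst A * staircase w g

theorem rowEvolve_mul {q : ℕ} {w : ℕ} (g : Fin w → Gate q) (A B : Op q w) :
    rowEvolve w g A * rowEvolve w g B = rowEvolve w g (A * B) := by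
  have h : staircase w g * (staircase w g).conjTranspose = 1 :=
    Matrix.mem_unitaryGroup_iff.1 (staircase_mem_unitary w g)
  simp only [rowEvolve, map_mul, mul_assoc]
  rw [← mul_assoc (staircase w g) (staircase w g).conjTranspose, h, one_mul]

theorem rowEvolve_one {q : ℕ} {w : ℕ} (g : Fin w → Gate q) : rowEvolve w g 1 = 1 := by
  rw [rowEvolve, map_one, mul_one]
  exact Matrix.mem_unitaryGroup_iff'.1 (staircase_mem_unitary w g)

theorem trace_rowEvolve {q : ℕ} {w : ℕ} (g : Fin w → Gate q) (A : Op q w) :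
    (rowEvolve w g A).trace = q * A.trace := by
  have h : staircase w g * (staircase w g).conjTranspose = 1 :=
    Matrix.mem_unitaryGroup_iff.1 (staircase_mem_unitary w g)
  rw [rowEvolve, Matrix.trace_mul_cycle, h, one_mul, trace_addFirst]

theorem rowEvolve_conjTranspose {q : ℕ} {w : ℕ} (g : Fin w → Gate q) (A : Op q w) :
    rowEvolve w g A.conjTranspose = (rowEvolve w g A).conjTranspose := by
  simp [rowEvolve, Matrix.conjTranspose_mul, addFirst_conjTranspose, mul_assoc]

/-- The first gate of the row does not see an operator that is trivial on the first site. -/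
theorem rowEvolve_addFirst {q : ℕ} {w : ℕ} (g : Fin (w + 1) → Gate q) (A : Op q w) :
    rowEvolve (w + 1) g (addFirst A) = addFirst (rowEvolve w (fun k => g k.succ) A) := by
  have hc : Commute (addFirst (addFirst A)) (gateOp (w + 2) 0 (g 0).1) :=
    commute_addFirst_addFirst_gateOp _ _
  have h : (gateOp (w + 2) 0 (g 0).1).conjTranspose * gateOp (w + 2) 0 (g 0).1 = 1 :=
    Matrix.mem_unitaryGroup_iff'.1 (gateOp_mem_unitary _ _ _)
  rw [rowEvolve, staircase_succ, Matrix.conjTranspose_mul, rowEvolve, map_mul, map_mul,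
    addFirst_conjTranspose]
  calc _ = (addFirst (staircase w fun k => g k.succ)).conjTranspose *
        ((gateOp (w + 2) 0 (g 0).1).conjTranspose *
        (addFirst (addFirst A) * gateOp (w + 2) 0 (g 0).1)) *
        addFirst (staircase w fun k => g k.succ) := by simp only [mul_assoc]
    _ = _ := by rw [hc.eq, ← mul_assoc (gateOp _ _ _).conjTranspose, h, one_mul]

/-- `gateLLG` as a linear map. -/
noncomputable def gateLLGLin {q : ℕ} (w : ℕ) (g : Fin w → Gate q) : Module.End ℂ (State q w) where
  toFun := gateLLG w g
  map_add' v v' := by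
    simp only [gateLLG, ← addLeftLin_apply, ← contractLin_apply, map_add, mul_add, add_mul,
      smul_add]
  map_smul' c v := by
    simp only [gateLLG, ← addLeftLin_apply, ← contractLin_apply, map_smul, Matrix.mul_smul,
      Matrix.smul_mul, RingHom.id_apply]
    rw [smul_comm]

theorem gateLLGLin_apply {q : ℕ} (w : ℕ) (g : Fin w → Gate q) (v : State q w) :
    gateLLGLin w g v = gateLLG w g v := rfl

theorem gateLLG_kron {q : ℕ} {w : ℕ} (g : Fin w → Gate q) (A B : Op q w) :
    gateLLG w g (A ⊗ₖ B) =
      (q : ℂ)⁻¹ • contractRight (rowEvolve w g A ⊗ₖ rowEvolve w g B) := by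
  rw [gateLLG, addLeft_kron, Matrix.conjTranspose_kronecker, ← Matrix.mul_kronecker_mul,
    ← Matrix.mul_kronecker_mul]
  rfl

theorem swapTrace_gateLLG {q : ℕ} [NeZero q] {w : ℕ} (g : Fin w → Gate q) (v : State q w) :
    swapTrace q w (gateLLG w g v) = swapTrace q w v := by
  have : (swapTrace q w).comp (gateLLGLin w g) = swapTrace q w := hom_ext_kron fun A B => by
    rw [LinearMap.comp_apply, gateLLGLin_apply, gateLLG_kron, map_smul, swapTrace_contractRight,
      swapTrace_kron, swapTrace_kron, rowEvolve_mul, trace_rowEvolve, smul_eq_mul,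
      inv_mul_cancel_left₀ (NeZero.ne _)]
  exact LinearMap.congr_fun this v

/-- An operator that is trivial in the second copy stays so. -/
theorem gateLLG_kron_one {q : ℕ} {w : ℕ} (g : Fin w → Gate q) (A : Op q w) :
    gateLLG w g (A ⊗ₖ 1) = ((q : ℂ)⁻¹ • ∑ x, lastBlock x x (rowEvolve w g A)) ⊗ₖ 1 := by
  have h : ∀ x, ∑ y, lastBlock x y (rowEvolve w g A) ⊗ₖ lastBlock y x (1 : Op q (w + 1)) =
      lastBlock x x (rowEvolve w g A) ⊗ₖ 1 := fun x => by
    rw [Finset.sum_eq_single x (fun y _ hy => by simp [lastBlock_one, hy]) (by simp),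
      lastBlock_one, if_pos rfl]
  rw [gateLLG_kron, rowEvolve_one, contractRight_kron]
  simp only [h]
  ext a b
  simp [Matrix.sum_apply, Finset.sum_mul, mul_assoc]

/-- An operator that is trivial in the first copy stays so. -/
theorem gateLLG_one_kron {q : ℕ} {w : ℕ} (g : Fin w → Gate q) (A : Op q w) :
    gateLLG w g (1 ⊗ₖ A) = 1 ⊗ₖ ((q : ℂ)⁻¹ • ∑ x, lastBlock x x (rowEvolve w g A)) := by
  have h : ∀ x, ∑ y, lastBlock x y (1 : Op q (w + 1)) ⊗ₖ lastBlock y x (rowEvolve w g A) =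
      1 ⊗ₖ lastBlock x x (rowEvolve w g A) := fun x => by
    rw [Finset.sum_eq_single x (fun y _ hy => by simp [lastBlock_one, hy.symm]) (by simp),
      lastBlock_one, if_pos rfl]
  rw [gateLLG_kron, rowEvolve_one, contractRight_kron]
  simp only [h]
  ext a b
  simp [Matrix.sum_apply, Finset.mul_sum, mul_left_comm]

theorem gateLLG_addLeft {q : ℕ} {w : ℕ} (g : Fin (w + 1) → Gate q) (v : State q w) :
    gateLLG (w + 1) g (addLeft v) = addLeft (gateLLG w (fun k => g k.succ) v) := by
  have : (gateLLGLin (w + 1) g).comp addLeftLin =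
      addLeftLin.comp (gateLLGLin w fun k => g k.succ) := hom_ext_kron fun A B => by
    simp only [LinearMap.comp_apply, gateLLGLin_apply, gateLLG_kron, addLeftLin_apply, addLeft_kron,
      rowEvolve_addFirst]
    rw [← addLeft_kron, contractRight_addLeft, ← addLeftLin_apply, ← addLeftLin_apply, map_smul]
  exact LinearMap.congr_fun this v

theorem swapTrace_mul_contractRight {q n : ℕ} (C D : Op q n) (v : State q (n + 1)) :
    swapTrace q n ((C ⊗ₖ D) * contractRight v) =
      swapTrace q (n + 1) ((addLast C ⊗ₖ addLast D) * v) := by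
  have h := contractRight_mul_addLast C D 1 1 v
  rw [map_one, Matrix.one_kronecker_one, Matrix.one_kronecker_one, mul_one, mul_one] at h
  rw [← h, swapTrace_contractRight]

/-- The last gate of the row cancels by unitarity when its two output sites are contracted. -/
theorem contractRight_gateLLG {q : ℕ} {w : ℕ} (g : Fin (w + 1) → Gate q) (v : State q (w + 1)) :
    contractRight (gateLLG (w + 1) g v) = gateLLG w (fun k => g k.castSucc) (contractRight v) := by
  set V := staircase w fun k => g k.castSucc with hV
  set G := gateOp (w + 2) w (g (Fin.last w)).1 with hG
  have hGG : G * G.conjTranspose = 1 :=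
    Matrix.mem_unitaryGroup_iff.1 (gateOp_mem_unitary _ _ _)
  have hrow : ∀ A : Op q (w + 1), rowEvolve (w + 1) g A =
      G.conjTranspose * ((addLast V).conjTranspose * addFirst A * addLast V) * G := fun A => by
    rw [rowEvolve, staircase_succ_last, ← hV, ← hG, Matrix.conjTranspose_mul]
    simp only [mul_assoc]
  have hconj : ∀ C : Op q w, G * (addLast (addLast C) * G.conjTranspose) =
      addLast (addLast C) := fun C => by
    rw [← mul_assoc, ← (commute_addLast_addLast_gateOp C (g (Fin.last w)).1).eq, mul_assoc, hGG,
      mul_one]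
  have : contractLin.comp (gateLLGLin (w + 1) g) =
      (gateLLGLin w fun k => g k.castSucc).comp contractLin := hom_ext_kron fun A B => by
    have h1 : contractRight (contractRight (rowEvolve (w + 1) g A ⊗ₖ rowEvolve (w + 1) g B)) =
        contractRight (contractRight
          (((addLast V).conjTranspose * addFirst A * addLast V) ⊗ₖ
            ((addLast V).conjTranspose * addFirst B * addLast V))) := by
      refine eq_of_swapTrace_kron_mul fun C D => ?_
      rw [swapTrace_mul_contractRight, swapTrace_mul_contractRight, swapTrace_mul_contractRight,
        swapTrace_mul_contractRight, ← Matrix.mul_kronecker_mul, ← Matrix.mul_kronecker_mul,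
        swapTrace_kron, swapTrace_kron, hrow, hrow]
      generalize (addLast V).conjTranspose * addFirst A * addLast V = X
      generalize (addLast V).conjTranspose * addFirst B * addLast V = Y
      calc _ = (addLast (addLast C) * G.conjTranspose * X *
            (G * (addLast (addLast D) * G.conjTranspose)) * Y * G).trace := by
            simp only [mul_assoc]
        _ = (G * (addLast (addLast C) * G.conjTranspose) * X *
            (G * (addLast (addLast D) * G.conjTranspose)) * Y).trace := by
            rw [Matrix.trace_mul_comm]; simp only [mul_assoc]
        _ = _ := by rw [hconj, hconj]; simp only [mul_assoc]
    rw [LinearMap.comp_apply, LinearMap.comp_apply, gateLLGLin_apply, gateLLG_kron, map_smul,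
      contractLin_apply, h1, Matrix.mul_kronecker_mul, Matrix.mul_kronecker_mul,
      ← addLast_conjTranspose, contractRight_mul_addLast, ← addLeft_kron, contractRight_addLeft,
      gateLLGLin_apply, gateLLG, Matrix.conjTranspose_kronecker]
    rfl
  exact LinearMap.congr_fun this v

/-! ### Bounded measurable matrix-valued functions -/

/-- Bounded measurable complex functions. -/
def BddMeas {X : Type*} [MeasurableSpace X] (f : X → ℂ) : Prop :=
  Measurable f ∧ ∃ C : ℝ, ∀ x, ‖f x‖ ≤ C

section BddMeas

variable {X : Type*} [MeasurableSpace X]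

theorem BddMeas.const (c : ℂ) : BddMeas fun _ : X => c := ⟨measurable_const, ‖c‖, fun _ => le_rfl⟩

theorem BddMeas.mul {f g : X → ℂ} (hf : BddMeas f) (hg : BddMeas g) :
    BddMeas fun x => f x * g x := by
  obtain ⟨hf, C, hC⟩ := hf
  obtain ⟨hg, D, hD⟩ := hg
  refine ⟨hf.mul hg, C * D, fun x => ?_⟩
  rw [norm_mul]
  exact mul_le_mul (hC x) (hD x) (norm_nonneg _) ((norm_nonneg _).trans (hC x))

theorem BddMeas.sum {ι : Type*} {s : Finset ι} {f : ι → X → ℂ} (hf : ∀ i, BddMeas (f i)) :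
    BddMeas fun x => ∑ i ∈ s, f i x := by
  choose hm C hC using hf
  exact ⟨Finset.measurable_sum s fun i _ => hm i, ∑ i ∈ s, C i,
    fun x => (norm_sum_le _ _).trans (Finset.sum_le_sum fun i _ => hC i x)⟩

theorem BddMeas.star {f : X → ℂ} (hf : BddMeas f) : BddMeas fun x => star (f x) := by
  obtain ⟨hf, C, hC⟩ := hf
  exact ⟨Complex.continuous_conj.measurable.comp hf, C, fun x => by simpa using hC x⟩

theorem BddMeas.integrable {f : X → ℂ} (hf : BddMeas f) (μ : Measure X) [IsFiniteMeasure μ] :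
    Integrable f μ := by
  obtain ⟨hf, C, hC⟩ := hf
  exact Integrable.of_bound hf.aestronglyMeasurable C (Eventually.of_forall hC)

/-- Matrix-valued functions with bounded measurable entries. -/
def BddMeasMatrix {m n : Type*} (M : X → Matrix m n ℂ) : Prop := ∀ i j, BddMeas fun x => M x i j

theorem BddMeasMatrix.const {m n : Type*} (M : Matrix m n ℂ) : BddMeasMatrix fun _ : X => M :=
  fun _ _ => .const _

theorem BddMeasMatrix.mul {l m n : Type*} [Fintype m] {M : X → Matrix l m ℂ}
    {N : X → Matrix m n ℂ} (hM : BddMeasMatrix M) (hN : BddMeasMatrix N) :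
    BddMeasMatrix fun x => M x * N x := fun i j => by
  simp only [Matrix.mul_apply]
  exact .sum fun k => (hM i k).mul (hN k j)

theorem BddMeasMatrix.listProd {ι m : Type*} [Fintype m] [DecidableEq m]
    {M : ι → X → Matrix m m ℂ} (hM : ∀ i, BddMeasMatrix (M i)) (l : List ι) :
    BddMeasMatrix fun x => (l.map fun i => M i x).prod := by
  induction l with
  | nil => simpa using .const 1
  | cons i l ih => simpa using (hM i).mul ih

theorem BddMeasMatrix.conjTranspose {m n : Type*} {M : X → Matrix m n ℂ} (hM : BddMeasMatrix M) :
    BddMeasMatrix fun x => (M x).conjTranspose := fun i j => (hM j i).star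

theorem BddMeasMatrix.kronecker {l m n p : Type*} {M : X → Matrix l m ℂ} {N : X → Matrix n p ℂ}
    (hM : BddMeasMatrix M) (hN : BddMeasMatrix N) : BddMeasMatrix fun x => M x ⊗ₖ N x :=
  fun i j => (hM i.1 j.1).mul (hN i.2 j.2)

end BddMeas

/-! ### The averaged light-like generator -/

section Average

variable {Ω : Type*} [MeasurableSpace Ω]

/-- The matrix elements of the random gate `u` are measurable. -/
def MeasurableGate {X : Type*} [MeasurableSpace X] {q : ℕ} (u : X → Gate q) : Prop :=
  ∀ i j, Measurable fun ω => (u ω : Matrix (Fin q × Fin q) (Fin q × Fin q) ℂ) i j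

theorem bddMeasMatrix_gateOp {q : ℕ} {X : Type*} [MeasurableSpace X] {u : X → Gate q}
    (hu : MeasurableGate u)
    (n i : ℕ) : BddMeasMatrix fun ω => gateOp n i (u ω).1 := by
  intro a b
  by_cases hi : i + 1 < n
  · simp only [gateOp, dif_pos hi, Matrix.of_apply]
    split_ifs
    · exact ⟨hu _ _, 1, fun x => entry_norm_bound_of_unitary (u x).2 _ _⟩
    · exact .const _
  · simp only [gateOp, dif_neg hi]
    exact .const _

theorem bddMeasMatrix_gateLLG {q : ℕ} {u : Ω → Gate q}
    (hu : MeasurableGate u)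
    (w : ℕ) (v : State q w) :
    BddMeasMatrix fun ω : Fin w → Ω => gateLLG w (fun k => u (ω k)) v := by
  have hV : BddMeasMatrix fun ω : Fin w → Ω => staircase w fun k => u (ω k) :=
    .listProd (fun k => bddMeasMatrix_gateOp (u := fun ω : Fin w → Ω => u (ω k))
      (fun i j => (hu i j).comp (measurable_pi_apply k)) (w + 1) k) _
  have hY := ((hV.kronecker hV).conjTranspose.mul (.const (addLeft v))).mul (hV.kronecker hV)
  intro a b
  simp only [gateLLG, Matrix.smul_apply, smul_eq_mul, contractRight, Matrix.of_apply]
  exact (BddMeas.const _).mul (.sum fun x => .sum fun y => hY _ _)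

theorem apply_eq_sum_single {m n : Type*} [Fintype m] [Fintype n] [DecidableEq m] [DecidableEq n]
    (ℓ : Matrix m n ℂ →ₗ[ℂ] ℂ) (v : Matrix m n ℂ) :
    ℓ v = ∑ i, ∑ j, ℓ (Matrix.single i j 1) * v i j := by
  conv_lhs => rw [Matrix.matrix_eq_sum_single v]
  simp only [map_sum]
  refine Finset.sum_congr rfl fun i _ => Finset.sum_congr rfl fun j _ => ?_
  rw [← mul_one (v i j), ← smul_eq_mul, ← Matrix.smul_single, map_smul, smul_eq_mul, mul_comm,
    smul_eq_mul, mul_one]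

theorem bddMeas_map {X : Type*} [MeasurableSpace X] {m n : Type*} [Fintype m] [Fintype n]
    {M : X → Matrix m n ℂ} (hM : BddMeasMatrix M) (ℓ : Matrix m n ℂ →ₗ[ℂ] ℂ) :
    BddMeas fun x => ℓ (M x) := by
  classical
  simp only [apply_eq_sum_single ℓ (M _)]
  exact .sum fun i => .sum fun j => (BddMeas.const _).mul (hM i j)

variable {q : ℕ} (P : Measure Ω) {u : Ω → Gate q}

theorem genT_single (w : ℕ) (i j a b : Config q w × Config q w) :
    genT P u w (Matrix.single i j 1) a b =
      ∫ ω : Fin w → Ω, gateLLG w (fun k => u (ω k)) (Matrix.single i j 1) a b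
        ∂(Measure.pi fun _ : Fin w => P) := by
  rw [genT, ← Matrix.stdBasis_eq_single ℂ i j, Module.Basis.constr_basis,
    Matrix.stdBasis_eq_single]
  rfl

variable [IsProbabilityMeasure P]

theorem integrable_map_gateLLG (hu : MeasurableGate u) {w : ℕ} (ℓ : State q w →ₗ[ℂ] ℂ)
    (v : State q w) :
    Integrable (fun ω : Fin w → Ω => ℓ (gateLLG w (fun k => u (ω k)) v))
      (Measure.pi fun _ : Fin w => P) :=
  (bddMeas_map (bddMeasMatrix_gateLLG hu w v) ℓ).integrable _

/-- `genT` is the average of `gateLLG`, tested against an arbitrary linear functional. -/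
theorem map_genT (hu : MeasurableGate u) {w : ℕ} (ℓ : State q w →ₗ[ℂ] ℂ) (v : State q w) :
    ℓ (genT P u w v) = ∫ ω : Fin w → Ω, ℓ (gateLLG w (fun k => u (ω k)) v)
        ∂(Measure.pi fun _ : Fin w => P) := by
  let φ : State q w →ₗ[ℂ] ℂ :=
    { toFun := fun v => ∫ ω : Fin w → Ω, ℓ (gateLLGLin w (fun k => u (ω k)) v)
        ∂(Measure.pi fun _ : Fin w => P)
      map_add' := fun v v' => by
        simp only [map_add]
        exact integral_add (integrable_map_gateLLG P hu ℓ v) (integrable_map_gateLLG P hu ℓ v')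
      map_smul' := fun c v => by
        simp only [map_smul, smul_eq_mul, RingHom.id_apply]
        exact integral_const_mul _ _ }
  have : ℓ.comp (genT P u w) = φ := (Matrix.stdBasis ℂ _ _).ext fun e => by
    obtain ⟨i, j⟩ := e
    rw [Matrix.stdBasis_eq_single]
    change ℓ (genT P u w (Matrix.single i j 1)) =
      ∫ ω : Fin w → Ω, ℓ (gateLLG w (fun k => u (ω k)) (Matrix.single i j 1))
        ∂(Measure.pi fun _ : Fin w => P)
    rw [apply_eq_sum_single]
    simp_rw [genT_single, apply_eq_sum_single ℓ (gateLLG _ _ _)]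
    have hint : ∀ a b, Integrable (fun ω : Fin w → Ω => ℓ (Matrix.single a b 1) *
        gateLLG w (fun k => u (ω k)) (Matrix.single i j 1) a b)
        (Measure.pi fun _ : Fin w => P) := fun a b =>
      ((bddMeasMatrix_gateLLG hu w (Matrix.single i j 1) a b).integrable _).const_mul _
    rw [integral_finsetSum _ fun a _ => integrable_finsetSum _ fun b _ => hint a b]
    refine Finset.sum_congr rfl fun a _ => ?_
    rw [integral_finsetSum _ fun b _ => hint a b]
    exact Finset.sum_congr rfl fun b _ => (integral_const_mul _ _).symm
  exact LinearMap.congr_fun this v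

theorem eq_of_forall_map_eq {m n : Type*} {M N : Matrix m n ℂ}
    (h : ∀ ℓ : Matrix m n ℂ →ₗ[ℂ] ℂ, ℓ M = ℓ N) : M = N := by
  ext i j
  exact h (Matrix.entryLinearMap ℂ ℂ i j)

theorem integral_pi_castSucc {w : ℕ} {E : Type*} [NormedAddCommGroup E] [NormedSpace ℝ E]
    (f : (Fin w → Ω) → E) :
    ∫ ω : Fin (w + 1) → Ω, f (fun k => ω k.castSucc) ∂(Measure.pi fun _ : Fin (w + 1) => P) =
      ∫ ω, f ω ∂(Measure.pi fun _ : Fin w => P) := by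
  have h := (measurePreserving_piFinSuccAbove (fun _ : Fin (w + 1) => P)
    (Fin.last w)).integral_comp' (g := fun p => f p.2)
  rw [integral_fun_snd] at h
  simp only [probReal_univ, one_smul] at h
  rw [← h]
  congr with ω
  congr with k
  simp [MeasurableEquiv.piFinSuccAbove, Fin.insertNthEquiv, Fin.init]

theorem integral_pi_succ {w : ℕ} {E : Type*} [NormedAddCommGroup E] [NormedSpace ℝ E]
    (f : (Fin w → Ω) → E) :
    ∫ ω : Fin (w + 1) → Ω, f (fun k => ω k.succ) ∂(Measure.pi fun _ : Fin (w + 1) => P) =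
      ∫ ω, f ω ∂(Measure.pi fun _ : Fin w => P) := by
  have h := (measurePreserving_piFinSuccAbove (fun _ : Fin (w + 1) => P) 0).integral_comp'
    (g := fun p => f p.2)
  rw [integral_fun_snd] at h
  simp only [probReal_univ, one_smul] at h
  rw [← h]
  rfl

theorem genT_addLeft (hu : MeasurableGate u) {w : ℕ} (v : State q w) :
    genT P u (w + 1) (addLeft v) = addLeft (genT P u w v) := by
  refine eq_of_forall_map_eq fun ℓ => ?_
  rw [map_genT P hu, ← addLeftLin_apply (genT P u w v), ← LinearMap.comp_apply, map_genT P hu]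
  simp only [LinearMap.comp_apply, addLeftLin_apply, gateLLG_addLeft]
  exact integral_pi_succ P fun ω => ℓ (addLeft (gateLLG w (fun k => u (ω k)) v))

theorem contractRight_genT (hu : MeasurableGate u) {w : ℕ} (v : State q (w + 1)) :
    contractRight (genT P u (w + 1) v) = genT P u w (contractRight v) := by
  refine eq_of_forall_map_eq fun ℓ => ?_
  rw [map_genT P hu, ← contractLin_apply, ← LinearMap.comp_apply, map_genT P hu]
  simp only [LinearMap.comp_apply, contractLin_apply, contractRight_gateLLG]
  exact integral_pi_castSucc P fun ω => ℓ (gateLLG w (fun k => u (ω k)) (contractRight v))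

theorem swapTrace_genT [NeZero q] (hu : MeasurableGate u) {w : ℕ} (v : State q w) :
    swapTrace q w (genT P u w v) = swapTrace q w v := by
  rw [map_genT P hu]
  simp [swapTrace_gateLLG]

theorem genT_one [NeZero q] (hu : MeasurableGate u) (w : ℕ) : genT P u w 1 = 1 := by
  have h : ∀ g : Fin w → Gate q, gateLLG w g 1 = 1 := fun g => by
    rw [← Matrix.one_kronecker_one, gateLLG_kron_one, rowEvolve_one]
    simp only [lastBlock_one, if_true, Finset.sum_const, Finset.card_univ, Fintype.card_fin,
      ← Nat.cast_smul_eq_nsmul ℂ, smul_smul]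
    rw [inv_mul_cancel₀ (NeZero.ne _), one_smul]
  refine eq_of_forall_map_eq fun ℓ => ?_
  rw [map_genT P hu]
  simp [h]

/-- `genT` preserves the span of the states `A ⊗ 𝟙`. -/
theorem map_genT_kron_one (hu : MeasurableGate u) {w : ℕ} (Ψ : State q w →ₗ[ℂ] State q w)
    (hΨ : ∀ B : Op q w, Ψ (B ⊗ₖ 1) = 0) (A : Op q w) : Ψ (genT P u w (A ⊗ₖ 1)) = 0 := by
  refine eq_of_forall_map_eq fun ℓ => ?_
  rw [← LinearMap.comp_apply, map_genT P hu]
  simp [gateLLG_kron_one, hΨ]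

/-- `genT` preserves the span of the states `𝟙 ⊗ A`. -/
theorem map_genT_one_kron (hu : MeasurableGate u) {w : ℕ} (Ψ : State q w →ₗ[ℂ] State q w)
    (hΨ : ∀ B : Op q w, Ψ (1 ⊗ₖ B) = 0) (A : Op q w) : Ψ (genT P u w (1 ⊗ₖ A)) = 0 := by
  refine eq_of_forall_map_eq fun ℓ => ?_
  rw [← LinearMap.comp_apply, map_genT P hu]
  simp [gateLLG_one_kron, hΨ]

end Average

/-! ### Positive functionals and positive maps on states -/

/-- A linear functional on states is positive if its real part is nonnegative on the states
`O† ⊗ O`. Imaginary parts are ignored, as only real parts are compared. -/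
def PosFunctional {q n : ℕ} (ℓ : State q n →ₗ[ℂ] ℂ) : Prop :=
  ∀ O : Op q n, 0 ≤ (ℓ (O.conjTranspose ⊗ₖ O)).re

/-- A linear map on states is positive if it pulls positive functionals back to positive
functionals; by duality, it preserves the closed convex cone generated by the states `O† ⊗ O`. -/
def PosMap {q n m : ℕ} (Φ : State q n →ₗ[ℂ] State q m) : Prop :=
  ∀ ℓ, PosFunctional ℓ → PosFunctional (ℓ.comp Φ)

/-- The order on functionals defined by the positive ones. -/
def FLe {q n : ℕ} (ℓ ℓ' : State q n →ₗ[ℂ] ℂ) : Prop := PosFunctional (ℓ' - ℓ)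

theorem fle_iff {q n : ℕ} {ℓ ℓ' : State q n →ₗ[ℂ] ℂ} :
    FLe ℓ ℓ' ↔ ∀ O : Op q n,
      (ℓ (O.conjTranspose ⊗ₖ O)).re ≤ (ℓ' (O.conjTranspose ⊗ₖ O)).re := by
  simp [FLe, PosFunctional]

theorem FLe.comp {q n m : ℕ} {ℓ ℓ' : State q m →ₗ[ℂ] ℂ} (h : FLe ℓ ℓ')
    {Φ : State q n →ₗ[ℂ] State q m} (hΦ : PosMap Φ) : FLe (ℓ.comp Φ) (ℓ'.comp Φ) := hΦ _ h

theorem PosMap.id {q n : ℕ} : PosMap (LinearMap.id : State q n →ₗ[ℂ] State q n) := fun _ h => h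

theorem PosMap.comp {q n m k : ℕ} {Φ : State q m →ₗ[ℂ] State q k} {Ψ : State q n →ₗ[ℂ] State q m}
    (hΦ : PosMap Φ) (hΨ : PosMap Ψ) : PosMap (Φ.comp Ψ) := fun ℓ hℓ => hΨ _ (hΦ ℓ hℓ)

theorem PosMap.pow {q n : ℕ} {Φ : Module.End ℂ (State q n)} (hΦ : PosMap Φ) (k : ℕ) :
    PosMap (Φ ^ k) := by
  induction k with
  | zero => exact PosMap.id
  | succ k ih => rw [pow_succ]; exact ih.comp hΦ

theorem swapTrace_conjTranspose_kron {q n : ℕ} (O : Op q n) :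
    swapTrace q n (O.conjTranspose ⊗ₖ O) = ((∑ a, ∑ b, ‖O a b‖ ^ 2 : ℝ) : ℂ) := by
  rw [swapTrace_kron, Matrix.trace]
  simp only [Matrix.diag_apply, Matrix.mul_apply, Matrix.conjTranspose_apply]
  rw [Finset.sum_comm]
  push_cast
  refine Finset.sum_congr rfl fun a _ => Finset.sum_congr rfl fun b _ => ?_
  rw [Complex.star_def, Complex.conj_mul']

theorem re_swapTrace {q n : ℕ} (O : Op q n) :
    (swapTrace q n (O.conjTranspose ⊗ₖ O)).re = ∑ a, ∑ b, ‖O a b‖ ^ 2 := by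
  rw [swapTrace_conjTranspose_kron, Complex.ofReal_re]

theorem posFunctional_swapTrace (q n : ℕ) : PosFunctional (swapTrace q n) := fun O => by
  rw [re_swapTrace]
  positivity

theorem contractRight_conjTranspose_kron {q n : ℕ} (O : Op q (n + 1)) :
    contractRight (O.conjTranspose ⊗ₖ O) =
      ∑ x, ∑ y, (lastBlock y x O).conjTranspose ⊗ₖ lastBlock y x O := by
  rw [contractRight_kron]
  rfl

theorem posMap_contractLin {q n : ℕ} : PosMap (contractLin (q := q) (n := n)) := fun ℓ hℓ O => by
  rw [LinearMap.comp_apply, contractLin_apply, contractRight_conjTranspose_kron]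
  simp only [map_sum, Complex.re_sum]
  exact Finset.sum_nonneg fun x _ => Finset.sum_nonneg fun y _ => hℓ _

theorem posMap_genT {Ω : Type*} [MeasurableSpace Ω] {q : ℕ} (P : Measure Ω)
    [IsProbabilityMeasure P] {u : Ω → Gate q} (hu : MeasurableGate u) (w : ℕ) :
    PosMap (genT P u w) := fun ℓ hℓ O => by
  have hg : ∀ g : Fin w → Gate q, 0 ≤ (ℓ (gateLLG w g (O.conjTranspose ⊗ₖ O))).re := fun g => by
    rw [gateLLG_kron, rowEvolve_conjTranspose, map_smul, smul_eq_mul,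
      show (q : ℂ)⁻¹ = (((q : ℝ)⁻¹ : ℝ) : ℂ) by push_cast; rfl, Complex.re_ofReal_mul]
    exact mul_nonneg (by positivity) (posMap_contractLin ℓ hℓ _)
  rw [LinearMap.comp_apply, map_genT P hu]
  have hint := integrable_map_gateLLG P hu ℓ (O.conjTranspose ⊗ₖ O)
  rw [← RCLike.re_eq_complex_re, ← integral_re hint]
  exact integral_nonneg fun ω => hg _

/-! ### Triviality on the first site -/

/-- The normalized partial trace over the first site, `O ↦ 𝟙 ⊗ tr₀ O / q`. -/
noncomputable def twirlFirst (q n : ℕ) : Op q (n + 1) →ₗ[ℂ] Op q (n + 1) :=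
  (q : ℂ)⁻¹ • (addFirst (q := q) (n := n)).toLinearMap.comp traceFirst

/-- The projection to the operators that are traceless on the first site. -/
noncomputable def tracelessFirst (q n : ℕ) : Op q (n + 1) →ₗ[ℂ] Op q (n + 1) :=
  LinearMap.id - twirlFirst q n

/-- `tracelessFirst` on both copies. -/
noncomputable def tracelessPart (q n : ℕ) : Module.End ℂ (State q (n + 1)) :=
  tensorMap (tracelessFirst q n) (tracelessFirst q n)

/-- `twirlFirst` on both copies. -/
noncomputable def twirlPart (q n : ℕ) : Module.End ℂ (State q (n + 1)) :=
  tensorMap (twirlFirst q n) (twirlFirst q n)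

theorem twirlFirst_apply {q n : ℕ} (O : Op q (n + 1)) :
    twirlFirst q n O = addFirst ((q : ℂ)⁻¹ • traceFirst O) := by
  rw [map_smul]; rfl

theorem tracelessFirst_apply {q n : ℕ} (O : Op q (n + 1)) :
    tracelessFirst q n O = O - twirlFirst q n O := rfl

theorem twirlFirst_conjTranspose {q n : ℕ} (O : Op q (n + 1)) :
    twirlFirst q n O.conjTranspose = (twirlFirst q n O).conjTranspose := by
  rw [twirlFirst_apply, twirlFirst_apply, ← addFirst_conjTranspose, traceFirst_conjTranspose,
    Matrix.conjTranspose_smul]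
  simp

theorem tracelessFirst_conjTranspose {q n : ℕ} (O : Op q (n + 1)) :
    tracelessFirst q n O.conjTranspose = (tracelessFirst q n O).conjTranspose := by
  rw [tracelessFirst_apply, tracelessFirst_apply, twirlFirst_conjTranspose,
    Matrix.conjTranspose_sub]

theorem tracelessPart_conjTranspose_kron {q n : ℕ} (O : Op q (n + 1)) :
    tracelessPart q n (O.conjTranspose ⊗ₖ O) =
      (tracelessFirst q n O).conjTranspose ⊗ₖ tracelessFirst q n O := by
  rw [tracelessPart, tensorMap_kron, tracelessFirst_conjTranspose]

theorem twirlPart_conjTranspose_kron {q n : ℕ} (O : Op q (n + 1)) :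
    twirlPart q n (O.conjTranspose ⊗ₖ O) =
      (twirlFirst q n O).conjTranspose ⊗ₖ twirlFirst q n O := by
  rw [twirlPart, tensorMap_kron, twirlFirst_conjTranspose]

theorem posMap_tracelessPart (q n : ℕ) : PosMap (tracelessPart q n) := fun ℓ hℓ O => by
  rw [LinearMap.comp_apply, tracelessPart_conjTranspose_kron]
  exact hℓ _

theorem twirlFirst_addFirst {q n : ℕ} [NeZero q] (A : Op q n) :
    twirlFirst q n (addFirst A) = addFirst A := by
  rw [twirlFirst_apply, traceFirst_addFirst, smul_smul, inv_mul_cancel₀ (NeZero.ne _), one_smul]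

theorem tracelessFirst_addFirst {q n : ℕ} [NeZero q] (A : Op q n) :
    tracelessFirst q n (addFirst A) = 0 := by
  rw [tracelessFirst_apply, twirlFirst_addFirst, sub_self]

theorem traceFirst_tracelessFirst {q n : ℕ} [NeZero q] (O : Op q (n + 1)) :
    traceFirst (tracelessFirst q n O) = 0 := by
  rw [tracelessFirst_apply, twirlFirst_apply, map_sub, traceFirst_addFirst, smul_smul,
    mul_inv_cancel₀ (NeZero.ne _), one_smul, sub_self]

/-- The normalized partial trace is an orthogonal projection. -/
theorem swapTrace_eq_traceless_add_twirl {q n : ℕ} [NeZero q] (O : Op q (n + 1)) :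
    swapTrace q (n + 1) (O.conjTranspose ⊗ₖ O) =
      swapTrace q (n + 1) (tracelessPart q n (O.conjTranspose ⊗ₖ O)) +
      swapTrace q (n + 1) (twirlPart q n (O.conjTranspose ⊗ₖ O)) := by
  rw [tracelessPart_conjTranspose_kron, twirlPart_conjTranspose_kron]
  set X := tracelessFirst q n O with hX
  set Y := twirlFirst q n O with hY
  have hO : O = X + Y := by rw [hX, hY, tracelessFirst_apply, sub_add_cancel]
  have hYX : (Y.conjTranspose * X).trace = 0 := by
    rw [hY, twirlFirst_apply, ← addFirst_conjTranspose, ← trace_traceFirst,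
      traceFirst_addFirst_mul, hX, traceFirst_tracelessFirst, mul_zero, Matrix.trace_zero]
  have hXY : (X.conjTranspose * Y).trace = 0 := by
    rw [← star_eq_zero, ← Matrix.trace_conjTranspose, Matrix.conjTranspose_mul,
      Matrix.conjTranspose_conjTranspose, hYX]
  simp only [swapTrace_kron]
  rw [hO, Matrix.conjTranspose_add, add_mul, mul_add, mul_add]
  simp only [Matrix.trace_add, hYX, hXY]
  ring

/-- A weighted form of the parallelogram inequality: the cross terms between the traceless and the
trivial part cost an arbitrarily small factor on the traceless part. -/
theorem fle_traceless_add_twirl {q n : ℕ} {ℓ : State q (n + 1) →ₗ[ℂ] ℂ} (hℓ : PosFunctional ℓ)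
    {δ : ℝ} (hδ : 0 < δ) :
    FLe ℓ ((1 + δ : ℝ) • ℓ.comp (tracelessPart q n) + (1 + δ⁻¹ : ℝ) • ℓ.comp (twirlPart q n)) := by
  refine fle_iff.2 fun O => ?_
  simp only [LinearMap.add_apply, LinearMap.smul_apply, LinearMap.comp_apply,
    tracelessPart_conjTranspose_kron, twirlPart_conjTranspose_kron, Complex.add_re,
    Complex.smul_re, smul_eq_mul]
  set X := tracelessFirst q n O with hX
  set Y := twirlFirst q n O with hY
  have hO : O = X + Y := by rw [hX, hY, tracelessFirst_apply, sub_add_cancel]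
  -- The coefficients have product one, so that the cross terms cancel those of `X + Y`.
  have hpos := hℓ (((√δ : ℝ) : ℂ) • X - (((√δ)⁻¹ : ℝ) : ℂ) • Y)
  have hs : √δ ≠ 0 := (Real.sqrt_pos.2 hδ).ne'
  have e1 : (((√δ : ℝ) : ℂ) • X - (((√δ)⁻¹ : ℝ) : ℂ) • Y).conjTranspose ⊗ₖ
      (((√δ : ℝ) : ℂ) • X - (((√δ)⁻¹ : ℝ) : ℂ) • Y) =
      ((δ : ℝ) : ℂ) • (X.conjTranspose ⊗ₖ X) + ((δ⁻¹ : ℝ) : ℂ) • (Y.conjTranspose ⊗ₖ Y)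
        - (X.conjTranspose ⊗ₖ Y + Y.conjTranspose ⊗ₖ X) := by
    have h1 : ((√δ : ℝ) : ℂ) * ((√δ : ℝ) : ℂ) = ((δ : ℝ) : ℂ) := by
      rw [← Complex.ofReal_mul, Real.mul_self_sqrt hδ.le]
    have h2 : (((√δ)⁻¹ : ℝ) : ℂ) * (((√δ)⁻¹ : ℝ) : ℂ) = ((δ⁻¹ : ℝ) : ℂ) := by
      rw [← Complex.ofReal_mul, ← mul_inv, Real.mul_self_sqrt hδ.le]
    have h3 : ((√δ : ℝ) : ℂ) * (((√δ)⁻¹ : ℝ) : ℂ) = 1 := by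
      rw [← Complex.ofReal_mul, mul_inv_cancel₀ hs, Complex.ofReal_one]
    rw [← h1, ← h2]
    ext a b
    simp only [Matrix.kroneckerMap_apply, Matrix.conjTranspose_apply, Matrix.sub_apply,
      Matrix.smul_apply, Matrix.add_apply, smul_eq_mul, star_sub, star_mul', Complex.star_def,
      Complex.conj_ofReal]
    linear_combination (-(starRingEnd ℂ) (X b.1 a.1) * Y a.2 b.2 -
      (starRingEnd ℂ) (Y b.1 a.1) * X a.2 b.2) * h3
  have e2 : O.conjTranspose ⊗ₖ O = X.conjTranspose ⊗ₖ X + Y.conjTranspose ⊗ₖ Y +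
      (X.conjTranspose ⊗ₖ Y + Y.conjTranspose ⊗ₖ X) := by
    rw [hO, Matrix.conjTranspose_add, Matrix.add_kronecker, Matrix.kronecker_add,
      Matrix.kronecker_add]
    abel
  rw [e1] at hpos
  rw [e2]
  simp only [map_add, map_sub, map_smul, smul_eq_mul, Complex.add_re, Complex.sub_re,
    Complex.re_ofReal_mul] at hpos ⊢
  linarith

theorem tracelessFirst_lastBlock {q n : ℕ} (x y : Fin q) (A : Op q (n + 2)) :
    tracelessFirst q n (lastBlock x y A) = lastBlock x y (tracelessFirst q (n + 1) A) := by
  rw [tracelessFirst_apply, tracelessFirst_apply, twirlFirst_apply, twirlFirst_apply,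
    traceFirst_lastBlock]
  have : (q : ℂ)⁻¹ • lastBlock x y (traceFirst A) = lastBlock x y ((q : ℂ)⁻¹ • traceFirst A) := rfl
  rw [this, ← lastBlock_addFirst]
  rfl

theorem contractRight_tracelessPart {q n : ℕ} (v : State q (n + 2)) :
    contractRight (tracelessPart q (n + 1) v) = tracelessPart q n (contractRight v) := by
  have : contractLin.comp (tracelessPart q (n + 1)) =
      (tracelessPart q n).comp contractLin := hom_ext_kron fun A B => by
    simp only [LinearMap.comp_apply, contractLin_apply, tracelessPart, tensorMap_kron,
      contractRight_kron, map_sum, tracelessFirst_lastBlock]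
  exact LinearMap.congr_fun this v

/-! ### The weight of the nontrivial part -/

/-- The functional `v ↦ tr (S v) - q^(-n) tr v`. On `O† ⊗ O` it is the squared Hilbert–Schmidt
norm of the traceless part of `O`. -/
noncomputable def tracelessWeight (q n : ℕ) : State q n →ₗ[ℂ] ℂ :=
  swapTrace q n - ((q : ℂ) ^ n)⁻¹ • Matrix.traceLinearMap (Config q n × Config q n) ℂ ℂ

theorem tracelessWeight_apply {q n : ℕ} (v : State q n) :
    tracelessWeight q n v = swapTrace q n v - ((q : ℂ) ^ n)⁻¹ * v.trace := rfl

theorem tracelessWeight_addLeft {q n : ℕ} [NeZero q] (v : State q n) :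
    tracelessWeight q (n + 1) (addLeft v) = q * tracelessWeight q n v := by
  have : (q : ℂ) ≠ 0 := NeZero.ne _
  rw [tracelessWeight_apply, tracelessWeight_apply, swapTrace_addLeft, trace_addLeft, pow_succ]
  field_simp

theorem re_tracelessWeight {q n : ℕ} (O : Op q n) :
    (tracelessWeight q n (O.conjTranspose ⊗ₖ O)).re =
      (swapTrace q n (O.conjTranspose ⊗ₖ O)).re - ((q : ℝ) ^ n)⁻¹ * ‖O.trace‖ ^ 2 := by
  rw [tracelessWeight_apply, Matrix.trace_kronecker, Matrix.trace_conjTranspose, Complex.star_def,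
    Complex.conj_mul', Complex.sub_re]
  congr 1
  rw [← Complex.ofReal_natCast, ← Complex.ofReal_pow, ← Complex.ofReal_inv, ← Complex.ofReal_pow,
    Complex.re_ofReal_mul, Complex.ofReal_re]

theorem posFunctional_tracelessWeight (q n : ℕ) [NeZero q] :
    PosFunctional (tracelessWeight q n) := fun O => by
  have hq : (0 : ℝ) < (q : ℝ) ^ n := pow_pos (Nat.cast_pos.2 (NeZero.pos q)) n
  rw [re_tracelessWeight, re_swapTrace, sub_nonneg, inv_mul_le_iff₀ hq]
  calc ‖O.trace‖ ^ 2 ≤ (∑ a, ‖O a a‖) ^ 2 := by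
        gcongr
        exact norm_sum_le _ _
    _ ≤ Fintype.card (Config q n) * ∑ a, ‖O a a‖ ^ 2 := by
        simpa using sq_sum_le_card_mul_sum_sq (s := Finset.univ) (f := fun a => ‖O a a‖)
    _ ≤ (q : ℝ) ^ n * ∑ a, ∑ b, ‖O a b‖ ^ 2 := by
        rw [Fintype.card_fun, Fintype.card_fin, Fintype.card_fin, Nat.cast_pow]
        gcongr with a
        exact Finset.single_le_sum (f := fun b => ‖O a b‖ ^ 2) (fun b _ => by positivity)
          (Finset.mem_univ a)

theorem tracelessWeight_fle (q n : ℕ) : FLe (tracelessWeight q n) (swapTrace q n) :=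
  fle_iff.2 fun O => by
    rw [re_tracelessWeight]
    have : 0 ≤ ((q : ℝ) ^ n)⁻¹ * ‖O.trace‖ ^ 2 := by positivity
    linarith

/-! ### Growth of powers -/

/-- Powers of an endomorphism grow at most like `r ^ n` if all eigenvalues are smaller than `r`. -/
theorem exists_norm_map_pow_le_mul_norm {E : Type*} [NormedAddCommGroup E] [NormedSpace ℂ E]
    [FiniteDimensional ℂ E] (f : Module.End ℂ E) {r : ℝ} (hr0 : 0 < r)
    (hr : ∀ z : ℂ, f.HasEigenvalue z → ‖z‖ < r) (ℓ : E →ₗ[ℂ] ℂ) :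
    ∃ K : ℝ, 0 ≤ K ∧ ∀ (n : ℕ) (v : E), ‖ℓ ((f ^ n) v)‖ ≤ K * r ^ n * ‖v‖ := by
  rcases subsingleton_or_nontrivial E with hE | hE
  · exact ⟨0, le_rfl, fun n v => by rw [Subsingleton.elim ((f ^ n) v) 0]; simp⟩
  have : CompleteSpace E := FiniteDimensional.complete ℂ E
  set Φ := Module.End.toContinuousLinearMap (𝕜 := ℂ) E
  have hΦ : ∀ (n : ℕ) (v : E), (f ^ n) v = (Φ f ^ n) v := fun n v => by
    rw [← map_pow]; rfl
  lift r to NNReal using hr0.le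
  have hspec : spectralRadius ℂ (Φ f) < r := by
    refine spectrum.spectralRadius_lt_of_forall_lt_of_nonempty (spectrum.nonempty _) fun z hz => ?_
    rw [AlgEquiv.spectrum_eq, ← Module.End.hasEigenvalue_iff_mem_spectrum] at hz
    exact_mod_cast hr z hz
  have hev := (spectrum.pow_nnnorm_pow_one_div_tendsto_nhds_spectralRadius
    (Φ f)).eventually_lt_const hspec
  obtain ⟨N, hN⟩ := eventually_atTop.1 hev
  have hbound : ∀ n, N ≤ n → 1 ≤ n → ‖Φ f ^ n‖ ≤ (r : ℝ) ^ n := fun n hn hn1 => by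
    have h1 := hN n hn
    have hn0 : (0 : ℝ) < n := by exact_mod_cast hn1
    have h2 := ENNReal.rpow_le_rpow h1.le hn0.le
    rw [← ENNReal.rpow_mul, one_div, inv_mul_cancel₀ hn0.ne', ENNReal.rpow_one,
      ENNReal.rpow_natCast] at h2
    exact_mod_cast h2
  set ℓ' : E →L[ℂ] ℂ := LinearMap.toContinuousLinearMap ℓ
  refine ⟨‖ℓ'‖ * (1 + ∑ k ∈ Finset.range (N + 1), ‖Φ f ^ k‖ / (r : ℝ) ^ k), by positivity,
    fun n v => ?_⟩
  rw [hΦ, mul_assoc, mul_assoc]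
  refine (ℓ'.le_opNorm _).trans (mul_le_mul_of_nonneg_left ?_ (norm_nonneg _))
  rw [← mul_assoc]
  refine ((Φ f ^ n).le_opNorm v).trans (mul_le_mul_of_nonneg_right ?_ (norm_nonneg v))
  rw [← div_le_iff₀ (pow_pos hr0 n)]
  rcases Nat.lt_or_ge n (N + 1) with hn | hn
  · have := Finset.single_le_sum (f := fun k => ‖Φ f ^ k‖ / (r : ℝ) ^ k)
      (fun k _ => by positivity) (Finset.mem_range.2 hn)
    linarith
  · have h1 : ‖Φ f ^ n‖ / (r : ℝ) ^ n ≤ 1 :=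
      (div_le_one (pow_pos hr0 n)).2 (hbound n (by omega) (by omega))
    have : 0 ≤ ∑ k ∈ Finset.range (N + 1), ‖Φ f ^ k‖ / (r : ℝ) ^ k := by positivity
    linarith

/-- A linear factor is dominated by a slightly faster exponential. -/
theorem exists_linear_mul_pow_le (A B : ℝ) {x y : ℝ} (hx : 0 ≤ x) (hxy : x < y) :
    ∃ K : ℝ, 0 ≤ K ∧ ∀ n : ℕ, (A + n * B) * x ^ n ≤ K * y ^ n := by
  have hy : 0 < y := hx.trans_lt hxy
  have h1 : |x / y| < 1 := by
    rw [abs_of_nonneg (by positivity), div_lt_one hy]; exact hxy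
  have ht : Tendsto (fun n : ℕ => A * (x / y) ^ n + B * (n * (x / y) ^ n)) atTop
      (𝓝 (A * 0 + B * 0)) :=
    ((tendsto_pow_atTop_nhds_zero_of_abs_lt_one h1).const_mul A).add
      ((tendsto_self_mul_const_pow_of_abs_lt_one h1).const_mul B)
  obtain ⟨K, hK⟩ := ht.bddAbove_range
  refine ⟨max K 0, le_max_right _ _, fun n => ?_⟩
  have := (hK ⟨n, rfl⟩).trans (le_max_left K 0)
  have hyn : (0 : ℝ) < y ^ n := pow_pos hy n
  calc (A + n * B) * x ^ n = (A * (x / y) ^ n + B * (n * (x / y) ^ n)) * y ^ n := by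
        rw [div_pow]; field_simp
    _ ≤ _ := mul_le_mul_of_nonneg_right this hyn.le

/-! ### Operators that stay on the light cone -/

section Decay

variable {Ω : Type*} [MeasurableSpace Ω] {q : ℕ}

theorem swapTrace_twirlPart_fle [NeZero q] (n : ℕ) :
    FLe ((swapTrace q (n + 1)).comp (twirlPart q n)) (swapTrace q (n + 1)) :=
  fle_iff.2 fun O => by
    have := posMap_tracelessPart q n _ (posFunctional_swapTrace q (n + 1)) O
    rw [swapTrace_eq_traceless_add_twirl O, Complex.add_re]
    simpa using this

variable (P : Measure Ω) (u : Ω → Gate q)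

theorem genF_apply (w : ℕ) (v : State q w) :
    genF P u w v = genT P u w v - (((q : ℂ) ^ w)⁻¹ * swapTrace q w v) • 1 := rfl

/-- One step of the dynamics in which the operator stays nontrivial on the first site. -/
noncomputable def edgeStep (n : ℕ) : Module.End ℂ (State q (n + 1)) :=
  tracelessPart q n * genT P u (n + 1)

theorem tracelessPart_one [NeZero q] (n : ℕ) : tracelessPart q n 1 = 0 := by
  rw [← Matrix.one_kronecker_one, tracelessPart, tensorMap_kron, ← map_one addFirst,
    tracelessFirst_addFirst, Matrix.zero_kronecker]

theorem edgeStep_eq_genF [NeZero q] (n : ℕ) :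
    edgeStep P u n = tracelessPart q n * genF P u (n + 1) := by
  ext1 v
  rw [edgeStep, Module.End.mul_apply, Module.End.mul_apply, genF_apply, map_sub, map_smul,
    tracelessPart_one, smul_zero, sub_zero]

theorem eq_traceless_add_smul_one (A : Op q 1) :
    ∃ a : ℂ, A = tracelessFirst q 0 A + a • 1 := by
  refine ⟨((q : ℂ)⁻¹ • traceFirst A) default default, ?_⟩
  rw [tracelessFirst_apply, twirlFirst_apply]
  conv_lhs => rw [← sub_add_cancel A (addFirst ((q : ℂ)⁻¹ • traceFirst A))]
  conv_lhs => enter [2]; rw [op_zero_eq_smul_one ((q : ℂ)⁻¹ • traceFirst A), map_smul, map_one]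

variable [IsProbabilityMeasure P] {u}

/-- On a single site, `edgeStep` does not see the states that are trivial in one of the copies: they
stay trivial in that copy, and are removed by the projection to the traceless part. Hence powers of
`edgeStep` are projected powers of `genF`. -/
theorem edgeStep_mul_tracelessPart [NeZero q] (hu : MeasurableGate u) :
    edgeStep P u 0 * tracelessPart q 0 = edgeStep P u 0 := by
  refine hom_ext_kron fun A B => ?_
  obtain ⟨a, ha⟩ := eq_traceless_add_smul_one A
  obtain ⟨b, hb⟩ := eq_traceless_add_smul_one B
  have h1 : ∀ X : Op q 1, edgeStep P u 0 (X ⊗ₖ 1) = 0 := fun X =>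
    map_genT_kron_one P hu (tracelessPart q 0) (fun Y => by
      rw [tracelessPart, tensorMap_kron, ← map_one addFirst, tracelessFirst_addFirst,
        Matrix.kronecker_zero]) X
  have h2 : ∀ X : Op q 1, edgeStep P u 0 (1 ⊗ₖ X) = 0 := fun X =>
    map_genT_one_kron P hu (tracelessPart q 0) (fun Y => by
      rw [tracelessPart, tensorMap_kron, ← map_one addFirst, tracelessFirst_addFirst,
        Matrix.zero_kronecker]) X
  rw [Module.End.mul_apply, tracelessPart, tensorMap_kron]
  conv_rhs => rw [ha, hb]
  rw [Matrix.add_kronecker, Matrix.kronecker_add, Matrix.smul_kronecker, Matrix.kronecker_smul]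
  simp only [map_add, map_smul, h1, h2, smul_zero, add_zero]

theorem edgeStep_pow_succ [NeZero q] (hu : MeasurableGate u) (s : ℕ) :
    edgeStep P u 0 ^ (s + 1) = tracelessPart q 0 * genF P u 1 ^ (s + 1) := by
  induction s with
  | zero => simpa using edgeStep_eq_genF P u 0
  | succ s ih =>
    rw [pow_succ', ih, ← mul_assoc, edgeStep_mul_tracelessPart P hu, edgeStep_eq_genF, mul_assoc,
      ← pow_succ']

theorem posMap_edgeStep (hu : MeasurableGate u) (n : ℕ) : PosMap (edgeStep P u n) :=
  (posMap_tracelessPart q n).comp (posMap_genT P hu (n + 1))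

theorem norm_conjTranspose_kron_apply_le {n : ℕ} (O : Op q n) (a b : Config q n × Config q n) :
    ‖(O.conjTranspose ⊗ₖ O) a b‖ ≤ (swapTrace q n (O.conjTranspose ⊗ₖ O)).re := by
  have h : ∀ a b, ‖O a b‖ ^ 2 ≤ ∑ a, ∑ b, ‖O a b‖ ^ 2 := fun a b =>
    (Finset.single_le_sum (f := fun b => ‖O a b‖ ^ 2) (fun b _ => by positivity)
      (Finset.mem_univ b)).trans
      (Finset.single_le_sum (f := fun a => ∑ b, ‖O a b‖ ^ 2) (fun a _ => by positivity)
        (Finset.mem_univ a))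
  rw [re_swapTrace, Matrix.kroneckerMap_apply, norm_mul, Matrix.conjTranspose_apply, norm_star]
  nlinarith [h b.1 a.1, h a.2 b.2, sq_nonneg (‖O b.1 a.1‖ - ‖O a.2 b.2‖)]

/-- A bound on the iterates of an endomorphism of the space of states, tested on product states. -/
theorem exists_norm_map_pow_le {n : ℕ} (f : Module.End ℂ (State q n)) {r : ℝ} (hr0 : 0 < r)
    (hr : ∀ z : ℂ, f.HasEigenvalue z → ‖z‖ < r) (ℓ : State q n →ₗ[ℂ] ℂ) :
    ∃ K : ℝ, 0 ≤ K ∧ ∀ (s : ℕ) (O : Op q n), ‖ℓ ((f ^ s) (O.conjTranspose ⊗ₖ O))‖ ≤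
      K * r ^ s * (swapTrace q n (O.conjTranspose ⊗ₖ O)).re := by
  let _ := Matrix.normedAddCommGroup (m := Config q n × Config q n)
    (n := Config q n × Config q n) (α := ℂ)
  let _ := Matrix.normedSpace (m := Config q n × Config q n)
    (n := Config q n × Config q n) (α := ℂ) (R := ℂ)
  obtain ⟨K, hK0, hK⟩ := exists_norm_map_pow_le_mul_norm f hr0 hr ℓ
  refine ⟨K, hK0, fun s O => (hK s _).trans ?_⟩
  gcongr
  exact (Matrix.norm_le_iff (posFunctional_swapTrace q n O)).2 fun a b =>
    norm_conjTranspose_kron_apply_le O a b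

/-- The weight of operators that stay on the light cone grows at most like `r ^ s`, for every `r`
above the moduli of the eigenvalues of the width-one generator. -/
theorem exists_edgeStep_le_one [NeZero q] (hu : MeasurableGate u) {r : ℝ} (hr0 : 0 < r)
    (hr : ∀ z : ℂ, (genF P u 1).HasEigenvalue z → ‖z‖ < r) :
    ∃ K : ℝ, 0 ≤ K ∧ ∀ (s : ℕ) (O : Op q 1),
      (swapTrace q 1 ((edgeStep P u 0 ^ s) (O.conjTranspose ⊗ₖ O))).re ≤
        K * r ^ s * (swapTrace q 1 (O.conjTranspose ⊗ₖ O)).re := by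
  obtain ⟨K, hK0, hK⟩ := exists_norm_map_pow_le (genF P u 1) hr0 hr
    ((swapTrace q 1).comp (tracelessPart q 0))
  refine ⟨K + 1, by positivity, fun s O => ?_⟩
  have hN := posFunctional_swapTrace q 1 O
  rcases s with _ | s
  · rw [pow_zero, pow_zero, Module.End.one_apply, mul_one]
    nlinarith
  · rw [edgeStep_pow_succ P hu]
    refine (Complex.re_le_norm _).trans ((hK (s + 1) O).trans ?_)
    gcongr
    linarith

theorem contractRight_edgeStep_pow (hu : MeasurableGate u) (n s : ℕ) (v : State q (n + 2)) :
    contractRight ((edgeStep P u (n + 1) ^ s) v) = (edgeStep P u n ^ s) (contractRight v) := by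
  induction s generalizing v with
  | zero => rfl
  | succ s ih =>
    rw [pow_succ, Module.End.mul_apply, ih, pow_succ, Module.End.mul_apply, edgeStep, edgeStep,
      Module.End.mul_apply, contractRight_tracelessPart, contractRight_genT P hu,
      Module.End.mul_apply]

/-- The decay on the light cone does not depend on the width of the chain: the sites behind the
light cone can be contracted first. -/
theorem edgeStep_le_of_edgeStep_le_one (hu : MeasurableGate u) {r K : ℝ}
    (h : ∀ (s : ℕ) (O : Op q 1),
      (swapTrace q 1 ((edgeStep P u 0 ^ s) (O.conjTranspose ⊗ₖ O))).re ≤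
        K * r ^ s * (swapTrace q 1 (O.conjTranspose ⊗ₖ O)).re)
    (n s : ℕ) (O : Op q (n + 1)) :
    (swapTrace q (n + 1) ((edgeStep P u n ^ s) (O.conjTranspose ⊗ₖ O))).re ≤
        K * r ^ s * (swapTrace q (n + 1) (O.conjTranspose ⊗ₖ O)).re := by
  induction n with
  | zero => exact h s O
  | succ n ih =>
    rw [← swapTrace_contractRight ((edgeStep P u (n + 1) ^ s) _),
      ← swapTrace_contractRight (O.conjTranspose ⊗ₖ O), contractRight_edgeStep_pow P hu,
      contractRight_conjTranspose_kron]
    simp only [map_sum, Complex.re_sum, Finset.mul_sum]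
    exact Finset.sum_le_sum fun x _ => Finset.sum_le_sum fun y _ => ih _

/-! ### Operators inside the light cone -/

/-- The induction step in the width: the part that is trivial on the first site is an operator on a
chain that is shorter by one site. -/
theorem tracelessWeight_twirlPart_le [NeZero q] (hu : MeasurableGate u) {w : ℕ} {ρ K : ℝ}
    (hρ : 0 ≤ ρ) (hK0 : 0 ≤ K)
    (hK : ∀ (n : ℕ) (O : Op q w),
      (tracelessWeight q w ((genT P u w ^ n) (O.conjTranspose ⊗ₖ O))).re ≤
        K * ρ ^ n * (swapTrace q w (O.conjTranspose ⊗ₖ O)).re) (n : ℕ) (O : Op q (w + 1)) :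
    (tracelessWeight q (w + 1) ((genT P u (w + 1) ^ n)
      (twirlPart q w (O.conjTranspose ⊗ₖ O)))).re ≤
      K * ρ ^ n * (swapTrace q (w + 1) (O.conjTranspose ⊗ₖ O)).re := by
  have hpow : ∀ v : State q w, (genT P u (w + 1) ^ n) (addLeft v) =
      addLeft ((genT P u w ^ n) v) := by
    induction n with
    | zero => exact fun v => rfl
    | succ n ih =>
      intro v
      rw [pow_succ, Module.End.mul_apply, genT_addLeft P hu, ih, pow_succ, Module.End.mul_apply]
  set O' : Op q w := (q : ℂ)⁻¹ • traceFirst O with hO'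
  have h1 : twirlPart q w (O.conjTranspose ⊗ₖ O) = addLeft (O'.conjTranspose ⊗ₖ O') := by
    rw [twirlPart_conjTranspose_kron, twirlFirst_apply, addLeft_kron, addFirst_conjTranspose]
  have hq : ∀ z : ℂ, ((q : ℂ) * z).re = q * z.re := fun z => by
    rw [← Complex.ofReal_natCast, Complex.re_ofReal_mul]
  have h2 := fle_iff.1 (swapTrace_twirlPart_fle w) O
  rw [LinearMap.comp_apply, h1, swapTrace_addLeft, hq] at h2
  rw [h1, hpow, tracelessWeight_addLeft, hq]
  calc (q : ℝ) * _ ≤ q * (K * ρ ^ n * (swapTrace q w (O'.conjTranspose ⊗ₖ O')).re) := by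
        gcongr
        exact hK n O'
    _ = K * ρ ^ n * (q * (swapTrace q w (O'.conjTranspose ⊗ₖ O')).re) := by ring
    _ ≤ _ := by gcongr

/-- The weight of the operators that are not trivial on the whole chain grows at most like
`ρ ^ n`, for every `ρ` above the moduli of the eigenvalues of the width-one generator. -/
theorem exists_tracelessWeight_le [NeZero q] (hu : MeasurableGate u) {r₀ : ℝ} (hr₀ : 0 ≤ r₀)
    (h₀ : ∀ z : ℂ, (genF P u 1).HasEigenvalue z → ‖z‖ ≤ r₀) (w : ℕ) {ρ : ℝ} (hρ : r₀ < ρ) :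
    ∃ K : ℝ, 0 ≤ K ∧ ∀ (n : ℕ) (O : Op q w),
      (tracelessWeight q w ((genT P u w ^ n) (O.conjTranspose ⊗ₖ O))).re ≤
        K * ρ ^ n * (swapTrace q w (O.conjTranspose ⊗ₖ O)).re := by
  induction w generalizing ρ with
  | zero =>
    refine ⟨0, le_rfl, fun n O => ?_⟩
    have : tracelessWeight q 0 = 0 := hom_ext_kron fun A B => by
      rw [tracelessWeight_apply, swapTrace_kron, Matrix.trace_kronecker]
      simp [Matrix.trace, Matrix.mul_apply]
    simp [this]
  | succ w ih =>
    -- Room between `r₀` and `ρ` for the rate `r` and for the loss `1 + δ` of every step.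
    obtain ⟨r, hr₀r, hrρ⟩ := exists_between hρ
    have hr : 0 < r := hr₀.trans_lt hr₀r
    obtain ⟨δ, hδ, hδρ⟩ : ∃ δ : ℝ, 0 < δ ∧ (1 + δ) * r < ρ := by
      refine ⟨(ρ - r) / (2 * r), by have := sub_pos.2 hrρ; positivity, ?_⟩
      have : (1 + (ρ - r) / (2 * r)) * r = (ρ + r) / 2 := by field_simp; ring
      linarith
    obtain ⟨C, hC0, hC⟩ := ih hr₀r
    obtain ⟨K₁, hK₁0, hK₁⟩ := exists_edgeStep_le_one P hu hr fun z hz => (h₀ z hz).trans_lt hr₀r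
    have hedge := edgeStep_le_of_edgeStep_le_one P hu hK₁ w
    set B : ℝ := (1 + δ⁻¹) * C * K₁ / r with hB
    have hB0 : 0 ≤ B := by positivity
    have hBr : B * r = (1 + δ⁻¹) * C * K₁ := by rw [hB]; field_simp
    -- The powers of `edgeStep` make the induction on `n` close: one step turns `s` into `s + 1`.
    have hmain : ∀ (n s : ℕ) (O : Op q (w + 1)),
        (tracelessWeight q (w + 1) ((genT P u (w + 1) ^ n)
          ((edgeStep P u w ^ s) (O.conjTranspose ⊗ₖ O)))).re ≤
        (K₁ + n * B) * ((1 + δ) ^ n * r ^ (n + s)) *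
          (swapTrace q (w + 1) (O.conjTranspose ⊗ₖ O)).re := by
      intro n
      induction n with
      | zero =>
        intro s O
        have h1 := fle_iff.1 ((tracelessWeight_fle q (w + 1)).comp
          ((posMap_edgeStep P hu w).pow s)) O
        simpa using h1.trans (hedge s O)
      | succ n ihn =>
        intro s O
        have hpos : PosFunctional ((tracelessWeight q (w + 1)).comp (genT P u (w + 1) ^ n)) :=
          (posMap_genT P hu (w + 1)).pow n _ (posFunctional_tracelessWeight q (w + 1))
        have hstep := fle_iff.1 ((fle_traceless_add_twirl hpos hδ).comp
          ((posMap_genT P hu (w + 1)).comp ((posMap_edgeStep P hu w).pow s))) O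
        have htw : FLe (((tracelessWeight q (w + 1)).comp (genT P u (w + 1) ^ n)).comp
            (twirlPart q w)) ((C * r ^ n : ℝ) • swapTrace q (w + 1)) := fle_iff.2 fun O => by
          have := tracelessWeight_twirlPart_le P hu hr.le hC0 hC n O
          simpa only [LinearMap.comp_apply, LinearMap.smul_apply, Complex.smul_re, smul_eq_mul]
            using this
        have htw' := fle_iff.1 (htw.comp
          ((posMap_genT P hu (w + 1)).comp ((posMap_edgeStep P hu w).pow s))) O
        have hs1 := ihn (s + 1) O
        have hs2 := hedge s O
        have hN := posFunctional_swapTrace q (w + 1) O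
        simp only [LinearMap.comp_apply, LinearMap.add_apply, LinearMap.smul_apply,
          Complex.add_re, Complex.smul_re, smul_eq_mul, swapTrace_genT P hu] at hstep htw'
        rw [pow_succ' (edgeStep P u w), Module.End.mul_apply] at hs1
        rw [pow_succ (genT P u (w + 1)), Module.End.mul_apply]
        set N := (swapTrace q (w + 1) (O.conjTranspose ⊗ₖ O)).re with hNdef
        have hδ1 : 0 ≤ 1 + δ⁻¹ := by positivity
        have hr1 : 1 ≤ (1 + δ) ^ (n + 1) := one_le_pow₀ (by linarith)
        calc _ ≤ _ := hstep
          _ ≤ (1 + δ) * ((K₁ + n * B) * ((1 + δ) ^ n * r ^ (n + (s + 1))) * N) +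
              (1 + δ⁻¹) * (C * r ^ n * (K₁ * r ^ s * N)) := by
            gcongr
            · exact hs1
            · exact htw'.trans (by gcongr)
          _ = (K₁ + n * B) * ((1 + δ) ^ (n + 1) * r ^ (n + 1 + s)) * N +
              (B * r) * r ^ n * r ^ s * N * 1 := by
            rw [hBr]; ring
          _ ≤ (K₁ + n * B) * ((1 + δ) ^ (n + 1) * r ^ (n + 1 + s)) * N +
              (B * r) * r ^ n * r ^ s * N * (1 + δ) ^ (n + 1) := by
            gcongr
          _ = _ := by push_cast; ring
    obtain ⟨K, hK0, hK⟩ := exists_linear_mul_pow_le K₁ B (by positivity) hδρ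
    refine ⟨K, hK0, fun n O => (hmain n 0 O).trans ?_⟩
    rw [add_zero, ← mul_pow]
    exact mul_le_mul_of_nonneg_right (hK n) (posFunctional_swapTrace q (w + 1) O)

end Decay

/-! ### From time layers to light-like rows -/

/-- In an ordered product, the last nontrivial factor can be split off. -/
theorem prod_finRange_eq_mul {M : Type*} [Monoid M] {w : ℕ} (f f' : Fin w → M) (k₀ : Fin w)
    (h : ∀ k, k ≠ k₀ → f k = f' k) (h₀ : f' k₀ = 1) (hlt : ∀ k, k₀ < k → f k = 1) :
    ((List.finRange w).map f).prod = ((List.finRange w).map f').prod * f k₀ := by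
  induction w with
  | zero => exact k₀.elim0
  | succ w ih =>
    simp only [List.finRange_succ_last, List.map_append, List.prod_append, List.map_map,
      List.map_cons, List.map_nil, List.prod_singleton]
    induction k₀ using Fin.lastCases with
    | last =>
      rw [h₀, mul_one]
      congr 2
      exact List.map_congr_left fun k _ => h _ (Fin.castSucc_lt_last k).ne
    | cast k₀ =>
      have hl : Fin.last w ≠ k₀.castSucc := (Fin.castSucc_lt_last k₀).ne'
      rw [← h _ hl, hlt _ (Fin.castSucc_lt_last k₀), mul_one, mul_one]
      refine ih (f ∘ Fin.castSucc) (f' ∘ Fin.castSucc) k₀ (fun k hk => h _ ?_) h₀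
        fun k hk => hlt _ hk
      simpa using hk

/-- The light-like row of gates that starts at the site `τ` of a chain of `n` sites. -/
def shiftedRow {q : ℕ} (n τ w : ℕ) (g : Fin w → Gate q) : Op q n :=
  ((List.finRange w).map fun k : Fin w => gateOp n (τ + k) (g k).1).prod

theorem shiftedRow_succ_succ {q : ℕ} (n τ w : ℕ) (g : Fin w → Gate q) :
    shiftedRow (n + 1) (τ + 1) w g = addFirst (shiftedRow n τ w g) := by
  rw [shiftedRow, shiftedRow, map_list_prod, List.map_map]
  congr 1
  refine List.map_congr_left fun k _ => ?_
  rw [Function.comp_apply, ← gateOp_succ_succ, Nat.add_right_comm]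

/-- The gate of the first row that belongs to the layer `s`, the rightmost gate of the layer. It is
the identity for `s ≥ w`. -/
def rowGate {q : ℕ} (n τ w : ℕ) (g : Fin w → Gate q) (s : ℕ) : Op q n :=
  if h : s < w then gateOp n (τ + s) (g ⟨s, h⟩).1 else 1

theorem prod_range_rowGate {q : ℕ} (n τ w m : ℕ) (g : Fin w → Gate q) :
    ((List.range (w + m)).map (rowGate n τ w g)).prod = shiftedRow n τ w g := by
  induction m with
  | zero =>
    rw [add_zero, ← List.map_coe_finRange_eq_range, List.map_map, shiftedRow]
    congr 1
    refine List.map_congr_left fun k _ => ?_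
    rw [Function.comp_apply, rowGate, dif_pos k.2]
  | succ m ih =>
    rw [← add_assoc, List.range_succ, List.map_append, List.prod_append, ih, List.map_singleton,
      List.prod_singleton, rowGate, dif_neg (by omega), mul_one]

theorem layer_zero {q : ℕ} (w τ : ℕ) (g : Fin (τ + 1) → Fin w → Gate q) :
    layer w (τ + 1) g 0 = rowGate (w + τ + 1) τ w (g 0) 0 := by
  rcases w with _ | w
  · simp [layer, rowGate]
  · rw [layer, prod_finRange_eq_mul _ (fun _ => 1) 0]
    · simp only [List.map_const', List.prod_replicate, one_pow, one_mul]
      rw [dif_pos ⟨le_rfl, by simp⟩, rowGate, dif_pos (Nat.succ_pos w)]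
      rfl
    · intro k hk
      rw [dif_neg]
      rintro ⟨h, -⟩
      exact hk (Fin.ext (Nat.le_zero.1 h))
    · rfl
    · intro k hk
      rw [dif_neg]
      rintro ⟨h, -⟩
      exact hk.ne' (Fin.ext (Nat.le_zero.1 h))

/-- A layer consists of the previous layer of the circuit without its first row, and of one gate of
the first row. -/
theorem layer_succ {q : ℕ} (w τ : ℕ) (g : Fin (τ + 1) → Fin w → Gate q) (s : ℕ) :
    layer w (τ + 1) g (s + 1) =
      addLast (layer w τ (fun j => g j.succ) s) * rowGate (w + τ + 1) τ w (g 0) (s + 1) := by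
  have hne : ∀ k : Fin w, (k : ℕ) ≠ s + 1 →
      (if h : (k : ℕ) ≤ s + 1 ∧ s + 1 - (k : ℕ) < τ + 1 then
        gateOp (w + (τ + 1)) (τ + 1 - 1 - (s + 1 - (k : ℕ)) + (k : ℕ))
          (g ⟨s + 1 - (k : ℕ), h.2⟩ k).1 else 1) =
      addLast (if h : (k : ℕ) ≤ s ∧ s - (k : ℕ) < τ then
        gateOp (w + τ) (τ - 1 - (s - (k : ℕ)) + (k : ℕ))
          (g (Fin.succ ⟨s - (k : ℕ), h.2⟩) k).1 else 1) := fun k hk => by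
    have hkw := k.2
    by_cases h : (k : ℕ) ≤ s ∧ s - (k : ℕ) < τ
    · rw [dif_pos h, dif_pos (by omega), ← gateOp_succ _ _ (by omega)]
      have e1 : τ + 1 - 1 - (s + 1 - (k : ℕ)) + (k : ℕ) = τ - 1 - (s - (k : ℕ)) + (k : ℕ) := by
        omega
      have e2 : (⟨s + 1 - (k : ℕ), by omega⟩ : Fin (τ + 1)) = Fin.succ ⟨s - (k : ℕ), h.2⟩ :=
        Fin.ext (by simp only [Fin.val_succ]; omega)
      rw [e1, e2]
      rfl
    · rw [dif_neg h, dif_neg (by omega), map_one]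
  rw [layer, layer, map_list_prod, List.map_map]
  by_cases hs : s + 1 < w
  · rw [prod_finRange_eq_mul _ (addLast ∘ fun k : Fin w =>
        if h : (k : ℕ) ≤ s ∧ s - (k : ℕ) < τ then
          gateOp (w + τ) (τ - 1 - (s - (k : ℕ)) + (k : ℕ))
            (g (Fin.succ ⟨s - (k : ℕ), h.2⟩) k).1 else 1) ⟨s + 1, hs⟩]
    · congr 1
      rw [rowGate, dif_pos hs, dif_pos (by simp)]
      simp
      rfl
    · exact fun k hk => hne k fun h => hk (Fin.ext h)
    · rw [Function.comp_apply, dif_neg (by simp), map_one]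
    · intro k hk
      rw [dif_neg]
      have : s + 1 < (k : ℕ) := hk
      omega
  · rw [rowGate, dif_neg hs, mul_one]
    congr 1
    exact List.map_congr_left fun k _ => hne k (by omega)

/-- The gates of the first row commute with the earlier layers of the other rows: their sites lie
strictly to the right of those layers. -/
theorem commute_layer_rowGate {q : ℕ} (w τ : ℕ) (g : Fin τ → Fin w → Gate q)
    (g' : Fin w → Gate q) {s s' : ℕ} (hs : s < s') :
    Commute (addLast (layer w τ g s)) (rowGate (w + τ + 1) τ w g' s') := by
  rw [layer, map_list_prod, List.map_map]
  refine Commute.list_prod_left _ _ fun x hx => ?_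
  obtain ⟨k, -, rfl⟩ := List.mem_map.1 hx
  rw [Function.comp_apply, rowGate]
  have hkw := k.2
  split_ifs with h1 h2
  · rw [← gateOp_succ _ _ (by omega)]
    exact commute_gateOp (by omega) _ _
  · exact Commute.one_right _
  · rw [map_one]; exact Commute.one_left _
  · exact Commute.one_right _

theorem prod_layer_succ {q : ℕ} (w τ : ℕ) (g : Fin (τ + 1) → Fin w → Gate q) (S : ℕ) :
    ((List.range (S + 1)).map (layer w (τ + 1) g)).prod =
      ((List.range (S + 1)).map (rowGate (w + τ + 1) τ w (g 0))).prod *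
        addLast ((List.range S).map (layer w τ fun j => g j.succ)).prod := by
  induction S with
  | zero => simp [layer_zero]
  | succ S ih =>
    have hc : Commute (addLast ((List.range (S + 1)).map (layer w τ fun j => g j.succ)).prod)
        (rowGate (w + τ + 1) τ w (g 0) (S + 1)) := by
      rw [map_list_prod, List.map_map]
      refine Commute.list_prod_left _ _ fun x hx => ?_
      obtain ⟨s, hs, rfl⟩ := List.mem_map.1 hx
      exact commute_layer_rowGate w τ _ _ (List.mem_range.1 hs)
    have hL : addLast ((List.range (S + 1)).map (layer w τ fun j => g j.succ)).prod =
        addLast ((List.range S).map (layer w τ fun j => g j.succ)).prod *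
          addLast (layer w τ (fun j => g j.succ) S) := by
      rw [← map_mul, List.range_succ (n := S), List.map_append, List.prod_append,
        List.map_singleton, List.prod_singleton]
    have hrange : ∀ f : ℕ → Op q (w + τ + 1), ((List.range (S + 1 + 1)).map f).prod =
        ((List.range (S + 1)).map f).prod * f (S + 1) := fun f => by
      rw [List.range_succ (n := S + 1), List.map_append, List.prod_append, List.map_singleton,
        List.prod_singleton]
    rw [hrange (rowGate (w + τ + 1) τ w (g 0)), mul_assoc, ← hc.eq, hL, mul_assoc, ← layer_succ,
      ← mul_assoc, ← ih]
    exact hrange _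

/-- The brick-wall circuit, built row by row in the light-like direction. -/
theorem evolution_succ {q : ℕ} (w τ : ℕ) (hw : 1 ≤ w) (g : Fin (τ + 1) → Fin w → Gate q) :
    evolution w (τ + 1) g = shiftedRow (w + τ + 1) τ w (g 0) *
      addLast (evolution w τ fun j => g j.succ) := by
  obtain ⟨S, hS⟩ : ∃ S, w + τ = S + 1 := ⟨w + τ - 1, by omega⟩
  rw [evolution, evolution, ← prod_range_rowGate _ _ _ τ, show w + (τ + 1) - 1 = S + 1 by omega,
    show w + τ - 1 = S by omega, show List.range (w + τ) = List.range (S + 1) by rw [hS]]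
  exact prod_layer_succ w τ g S

theorem evolution_zero {q : ℕ} (w : ℕ) (g : Fin 0 → Fin w → Gate q) : evolution w 0 g = 1 := by
  refine List.prod_eq_one fun x hx => ?_
  obtain ⟨s, -, rfl⟩ := List.mem_map.1 hx
  refine List.prod_eq_one fun x hx => ?_
  obtain ⟨k, -, rfl⟩ := List.mem_map.1 hx
  rw [dif_neg (by omega)]

/-! ### The circuit as a product of light-like generators -/

/-- `τ` sites, carrying the identity on both copies, are added on the left. -/
def padLeft {q w : ℕ} : (τ : ℕ) → State q w → State q (w + τ)
  | 0, v => v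
  | τ + 1, v => addLeft (padLeft τ v)

/-- `τ` sites, carrying the identity, are added on the left of an operator. -/
noncomputable def padFirst {q w : ℕ} : (τ : ℕ) → Op q w → Op q (w + τ)
  | 0, A => A
  | τ + 1, A => addFirst (padFirst τ A)

/-- `τ` sites, carrying the identity, are added on the right of an operator. -/
noncomputable def padLast {q w : ℕ} : (τ : ℕ) → Op q w → Op q (w + τ)
  | 0, A => A
  | τ + 1, A => addLast (padLast τ A)

theorem padLeft_kron {q w : ℕ} (τ : ℕ) (A B : Op q w) :
    padLeft τ (A ⊗ₖ B) = padFirst τ A ⊗ₖ padFirst τ B := by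
  induction τ with
  | zero => rfl
  | succ τ ih => rw [padLeft, ih, addLeft_kron]; rfl

theorem siteOp_padFirst {q w : ℕ} (τ i : ℕ) (A : Matrix (Fin q) (Fin q) ℂ) :
    siteOp (w + τ) (i + τ) A = padFirst τ (siteOp w i A) := by
  induction τ with
  | zero => rfl
  | succ τ ih => rw [padFirst, ← ih]; exact siteOp_succ_succ (w + τ) (i + τ) A

theorem siteOp_padLast {q w : ℕ} (τ i : ℕ) (hi : i < w) (A : Matrix (Fin q) (Fin q) ℂ) :
    siteOp (w + τ) i A = padLast τ (siteOp w i A) := by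
  induction τ with
  | zero => rfl
  | succ τ ih => rw [padLast, ← ih]; exact siteOp_succ (w + τ) i (by omega) A

theorem padLast_conjTranspose {q w : ℕ} (τ : ℕ) (A : Op q w) :
    padLast τ A.conjTranspose = (padLast τ A).conjTranspose := by
  induction τ with
  | zero => rfl
  | succ τ ih => rw [padLast, ih, addLast_conjTranspose]; rfl

theorem padFirst_conjTranspose {q w : ℕ} (τ : ℕ) (A : Op q w) :
    padFirst τ A.conjTranspose = (padFirst τ A).conjTranspose := by
  induction τ with
  | zero => rfl
  | succ τ ih => rw [padFirst, ih, addFirst_conjTranspose]; rfl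

theorem addLeft_mul_addFirst {q n : ℕ} (A B C D : Op q n) (v : State q n) :
    (addFirst A ⊗ₖ addFirst B) * addLeft v * (addFirst C ⊗ₖ addFirst D) =
      addLeft ((A ⊗ₖ B) * v * (C ⊗ₖ D)) := by
  have : ((LinearMap.mulRight ℂ (addFirst C ⊗ₖ addFirst D)).comp
      (LinearMap.mulLeft ℂ (addFirst A ⊗ₖ addFirst B))).comp addLeftLin =
      addLeftLin.comp ((LinearMap.mulRight ℂ (C ⊗ₖ D)).comp (LinearMap.mulLeft ℂ (A ⊗ₖ B))) :=
    hom_ext_kron fun X Y => by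
      simp only [LinearMap.comp_apply, LinearMap.mulRight_apply, LinearMap.mulLeft_apply,
        addLeftLin_apply, addLeft_kron, ← Matrix.mul_kronecker_mul, ← map_mul]
  exact LinearMap.congr_fun this v

theorem contractRight_shiftedRow {q w : ℕ} [NeZero q] (τ : ℕ) (g : Fin w → Gate q)
    (v : State q w) :
    contractRight (((shiftedRow (w + τ + 1) τ w g).conjTranspose ⊗ₖ
        (shiftedRow (w + τ + 1) τ w g).conjTranspose) * padLeft (τ + 1) v *
        (shiftedRow (w + τ + 1) τ w g ⊗ₖ shiftedRow (w + τ + 1) τ w g)) =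
      (q : ℂ) • padLeft τ (gateLLG w g v) := by
  induction τ with
  | zero =>
    have h : shiftedRow (w + 0 + 1) 0 w g = staircase w g := by
      simp only [shiftedRow, staircase, zero_add]
    rw [h, ← Matrix.conjTranspose_kronecker, padLeft, padLeft, gateLLG, smul_smul,
      mul_inv_cancel₀ (NeZero.ne _), one_smul]
    rfl
  | succ τ ih =>
    have h := shiftedRow_succ_succ (w + τ + 1) τ w g
    change contractRight (((shiftedRow (w + τ + 1 + 1) (τ + 1) w g).conjTranspose ⊗ₖ
        (shiftedRow (w + τ + 1 + 1) (τ + 1) w g).conjTranspose) * addLeft (padLeft (τ + 1) v) *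
        (shiftedRow (w + τ + 1 + 1) (τ + 1) w g ⊗ₖ shiftedRow (w + τ + 1 + 1) (τ + 1) w g)) = _
    rw [h, ← addFirst_conjTranspose, addLeft_mul_addFirst]
    refine (contractRight_addLeft _).trans ?_
    rw [ih, ← addLeftLin_apply, map_smul]
    rfl

/-- Successive application of the light-like generators of the rows. -/
noncomputable def applyRows {q w : ℕ} :
    (τ : ℕ) → (Fin τ → Fin w → Gate q) → State q w → State q w
  | 0, _, v => v
  | τ + 1, g, v => applyRows τ (fun j => g j.succ) (gateLLG w (g 0) v)

/-- Every row of the circuit acts, after the contraction of the rightmost site, as a light-like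
generator. -/
theorem swapTrace_evolution {q w : ℕ} [NeZero q] (hw : 1 ≤ w) (τ : ℕ)
    (g : Fin τ → Fin w → Gate q) (v : State q w) (A B : Op q w) :
    swapTrace q (w + τ) (((evolution w τ g).conjTranspose ⊗ₖ (evolution w τ g).conjTranspose) *
        padLeft τ v * (evolution w τ g ⊗ₖ evolution w τ g) * (padLast τ A ⊗ₖ padLast τ B)) =
      (q : ℂ) ^ τ * swapTrace q w (applyRows τ g v * (A ⊗ₖ B)) := by
  induction τ generalizing v with
  | zero =>
    rw [evolution_zero, Matrix.conjTranspose_one, Matrix.one_kronecker_one, pow_zero, one_mul,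
      one_mul, mul_one]
    rfl
  | succ τ ih =>
    have h := ih (fun j => g j.succ) (gateLLG w (g 0) v)
    rw [evolution_succ w τ hw]
    set R := shiftedRow (w + τ + 1) τ w (g 0) with hR
    set U := evolution w τ fun j => g j.succ
    have h1 : ((R * addLast U).conjTranspose ⊗ₖ (R * addLast U).conjTranspose) *
        padLeft (τ + 1) v * ((R * addLast U) ⊗ₖ (R * addLast U)) *
        (addLast (padLast τ A) ⊗ₖ addLast (padLast τ B)) =
        (addLast U.conjTranspose ⊗ₖ addLast U.conjTranspose) *
        ((R.conjTranspose ⊗ₖ R.conjTranspose) * padLeft (τ + 1) v * (R ⊗ₖ R)) *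
        (addLast (U * padLast τ A) ⊗ₖ addLast (U * padLast τ B)) := by
      rw [Matrix.conjTranspose_mul, Matrix.mul_kronecker_mul, Matrix.mul_kronecker_mul, map_mul,
        map_mul, Matrix.mul_kronecker_mul, addLast_conjTranspose]
      simp only [mul_assoc]
    have h2 : swapTrace q (w + τ + 1) (((R * addLast U).conjTranspose ⊗ₖ
        (R * addLast U).conjTranspose) *
        padLeft (τ + 1) v * ((R * addLast U) ⊗ₖ (R * addLast U)) *
        (addLast (padLast τ A) ⊗ₖ addLast (padLast τ B))) =
        (q : ℂ) ^ (τ + 1) * swapTrace q w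
          (applyRows τ (fun j => g j.succ) (gateLLG w (g 0) v) * (A ⊗ₖ B)) := by
      rw [h1, ← swapTrace_contractRight, contractRight_mul_addLast, hR, contractRight_shiftedRow,
        Matrix.mul_smul, Matrix.smul_mul, map_smul, pow_succ', mul_assoc (q : ℂ), ← h,
        smul_eq_mul, Matrix.mul_kronecker_mul]
      simp only [mul_assoc]
    exact h2

/-! ### Generalized Pauli matrices on a chain -/

theorem pauli_conjTranspose_mul {q : ℕ} [NeZero q] (μ : PauliIndex q) :
    (pauli μ).conjTranspose * pauli μ = 1 := by
  have hω : ∀ n : ℕ, (starRingEnd ℂ) (Complex.exp (2 * (Real.pi : ℂ) * Complex.I / (q : ℂ)) ^ n) *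
      Complex.exp (2 * (Real.pi : ℂ) * Complex.I / (q : ℂ)) ^ n = 1 := fun n => by
    have h : 2 * (Real.pi : ℂ) * Complex.I / (q : ℂ) =
        ((2 * Real.pi / q : ℝ) : ℂ) * Complex.I := by push_cast; ring
    rw [Complex.conj_mul', norm_pow, h, Complex.norm_exp_ofReal_mul_I]
    simp
  ext a b
  rw [Matrix.mul_apply, Finset.sum_eq_single (b + μ.2)]
  · simp only [Matrix.conjTranspose_apply, pauli, Matrix.of_apply, if_true, add_left_inj]
    by_cases h : b = a
    · subst h
      simpa using hω _
    · rw [if_neg h, star_zero, zero_mul, Matrix.one_apply_ne (Ne.symm h)]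
  · intro c _ hc
    simp [pauli, hc]
  · simp

/-- Placing a one-site operator on a chain is a homomorphism of `*`-algebras. -/
theorem exists_algHom_siteOp (q n i : ℕ) (hi : i < n) :
    ∃ φ : Matrix (Fin q) (Fin q) ℂ →ₐ[ℂ] Op q n,
      ∀ A, siteOp n i A = φ A ∧ φ A.conjTranspose = (φ A).conjTranspose := by
  induction n generalizing i with
  | zero => omega
  | succ n ih =>
    rcases i with _ | i
    · rcases Nat.lt_or_ge 0 n with hn | hn
      · obtain ⟨φ, h⟩ := ih 0 hn
        refine ⟨addLast.comp φ, fun u => ⟨?_, ?_⟩⟩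
        · rw [siteOp_succ n 0 hn, (h u).1]; rfl
        · simp [(h u).2, addLast_conjTranspose]
      · obtain rfl : n = 0 := by omega
        refine ⟨(Matrix.reindexAlgEquiv ℂ ℂ (Equiv.funUnique (Fin 1) (Fin q)).symm).toAlgHom,
          fun u => ⟨?_, rfl⟩⟩
        ext a b
        simp [siteOp]
    · obtain ⟨φ, h⟩ := ih i (by omega)
      refine ⟨addFirst.comp φ, fun u => ⟨?_, ?_⟩⟩
      · rw [siteOp_succ_succ, (h u).1]; rfl
      · simp [(h u).2, addFirst_conjTranspose]

theorem siteOp_pauli_conjTranspose_mul {q : ℕ} [NeZero q] (n i : ℕ) (μ : PauliIndex q) :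
    (siteOp n i (pauli μ)).conjTranspose * siteOp n i (pauli μ) = 1 := by
  by_cases hi : i < n
  · obtain ⟨φ, h⟩ := exists_algHom_siteOp q n i hi
    rw [(h _).1, ← (h _).2, ← map_mul, pauli_conjTranspose_mul, map_one]
  · simp [siteOp, hi]

/-! ### The correlator as a functional of the state -/

/-- The functional `v ↦ q^(-w) (tr (S v) - tr (S v (B† ⊗ B)))`. -/
noncomputable def otocFunctional {q w : ℕ} (B : Op q w) : State q w →ₗ[ℂ] ℂ :=
  ((q : ℂ) ^ w)⁻¹ • (swapTrace q w -
    (swapTrace q w).comp (LinearMap.mulRight ℂ (B.conjTranspose ⊗ₖ B)))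

theorem otocFunctional_apply {q w : ℕ} (B : Op q w) (v : State q w) :
    otocFunctional B v = ((q : ℂ) ^ w)⁻¹ * (swapTrace q w v -
      swapTrace q w (v * (B.conjTranspose ⊗ₖ B))) := rfl

theorem swapTrace_applyRows {q w : ℕ} [NeZero q] (τ : ℕ) (g : Fin τ → Fin w → Gate q)
    (v : State q w) : swapTrace q w (applyRows τ g v) = swapTrace q w v := by
  induction τ generalizing v with
  | zero => rfl
  | succ τ ih => rw [applyRows, ih, swapTrace_gateLLG]

theorem trace_one_op (q n : ℕ) : (1 : Op q n).trace = (q : ℂ) ^ n := by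
  rw [Matrix.trace_one, Fintype.card_fun, Fintype.card_fin, Fintype.card_fin, Nat.cast_pow]

theorem gateOTOC_eq {q w : ℕ} [NeZero q] (hw : 1 ≤ w) (τ : ℕ) (g : Fin τ → Fin w → Gate q)
    (μ ν : PauliIndex q) :
    gateOTOC w τ g μ ν = otocFunctional (siteOp w (w - 1) (pauli ν))
      (applyRows τ g ((siteOp w 0 (pauli μ)).conjTranspose ⊗ₖ siteOp w 0 (pauli μ))) := by
  have hq : (q : ℂ) ≠ 0 := NeZero.ne _
  set A := siteOp w 0 (pauli μ) with hA
  set B := siteOp w (w - 1) (pauli ν) with hB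
  have hB' : siteOp (w + τ) (w - 1) (pauli ν) = padLast τ B := siteOp_padLast τ _ (by omega) _
  have hA' : siteOp (w + τ) τ (pauli μ) = padFirst τ A := by
    have := siteOp_padFirst (w := w) τ 0 (pauli μ)
    rwa [zero_add] at this
  have h := swapTrace_evolution hw τ g (A.conjTranspose ⊗ₖ A) B.conjTranspose B
  rw [otocFunctional_apply, swapTrace_applyRows, swapTrace_kron, hA,
    siteOp_pauli_conjTranspose_mul, ← hA, trace_one_op, gateOTOC, expval, heisenberg, hA', hB']
  rw [padLeft_kron, ← Matrix.mul_kronecker_mul, ← Matrix.mul_kronecker_mul,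
    ← Matrix.mul_kronecker_mul, swapTrace_kron, padLast_conjTranspose, padFirst_conjTranspose] at h
  simp only [Matrix.conjTranspose_mul, Matrix.conjTranspose_conjTranspose, ← mul_assoc] at h ⊢
  rw [h, mul_sub, inv_mul_cancel₀ (pow_ne_zero _ hq), pow_add]
  field_simp

theorem otocFunctional_one {q w : ℕ} {B : Op q w} (h : B.conjTranspose * B = 1) :
    otocFunctional B 1 = 0 := by
  rw [otocFunctional_apply, one_mul, swapTrace_kron, h, ← Matrix.one_kronecker_one, swapTrace_kron,
    mul_one, sub_self, mul_zero]

/-- The real part of the correlator is half a squared commutator, which only sees the traceless part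
of the operator. -/
theorem otocFunctional_fle {q w : ℕ} [NeZero q] {B : Op q w} (h : B.conjTranspose * B = 1) :
    FLe (otocFunctional B) ((2 * ((q : ℝ) ^ w)⁻¹ : ℝ) • tracelessWeight q w) :=
  fle_iff.2 fun O => by
    have h' : B * B.conjTranspose = 1 := mul_eq_one_comm.1 h
    -- `O'` has the norm and the trace of `O`; positivity of the weight on `O + O'` bounds the
    -- correlation of `O` with `O'` from below.
    set O' := B.conjTranspose * O * B with hO'
    have htr : O'.trace = O.trace := by
      rw [hO', Matrix.trace_mul_cycle, h', one_mul]
    have hO'O' : (O'.conjTranspose * O').trace = (O.conjTranspose * O).trace := by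
      have : O'.conjTranspose * O' = B.conjTranspose * (O.conjTranspose * O) * B := by
        simp only [hO', Matrix.conjTranspose_mul, Matrix.conjTranspose_conjTranspose, mul_assoc]
        rw [← mul_assoc B B.conjTranspose, h', one_mul]
      rw [this, Matrix.trace_mul_cycle, h', one_mul]
    have hsymm : (O'.conjTranspose * O).trace.re = (O.conjTranspose * O').trace.re := by
      rw [← Complex.conj_re, ← Complex.star_def, ← Matrix.trace_conjTranspose,
        Matrix.conjTranspose_mul, Matrix.conjTranspose_conjTranspose]
    have hpos := posFunctional_tracelessWeight q w (O + O')
    have hw : (swapTrace q w ((O.conjTranspose ⊗ₖ O) * (B.conjTranspose ⊗ₖ B))).re =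
        (O.conjTranspose * O').trace.re := by
      rw [← Matrix.mul_kronecker_mul, swapTrace_kron, hO']
      simp only [mul_assoc]
    rw [re_tracelessWeight, Matrix.trace_add, htr, ← two_mul, norm_mul, swapTrace_kron,
      Matrix.conjTranspose_add, add_mul, mul_add, mul_add, Matrix.trace_add, Matrix.trace_add,
      Matrix.trace_add, hO'O', Complex.add_re, Complex.add_re, Complex.add_re, hsymm] at hpos
    have hc : (((q : ℂ) ^ w)⁻¹) = ((((q : ℝ) ^ w)⁻¹ : ℝ) : ℂ) := by push_cast; rfl
    rw [otocFunctional_apply, LinearMap.smul_apply, Complex.smul_re, re_tracelessWeight, hc,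
      Complex.re_ofReal_mul, Complex.sub_re, hw, swapTrace_kron, smul_eq_mul, mul_comm (2 : ℝ),
      mul_assoc]
    have hq : (0 : ℝ) ≤ ((q : ℝ) ^ w)⁻¹ := by positivity
    refine mul_le_mul_of_nonneg_left ?_ hq
    simp only [Complex.norm_ofNat] at hpos
    nlinarith

/-! ### Averaging over the rows -/

section Rows

variable {Ω : Type*} [MeasurableSpace Ω] {q : ℕ} (P : Measure Ω) [IsProbabilityMeasure P]
  {u : Ω → Gate q}

theorem map_applyRows_succ {w : ℕ} (τ : ℕ) (g : Fin (τ + 1) → Fin w → Gate q)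
    (ℓ : State q w →ₗ[ℂ] ℂ) (v : State q w) :
    ℓ (applyRows (τ + 1) g v) =
      ∑ a, ∑ b, gateLLG w (g 0) v a b *
        ℓ (applyRows τ (fun j => g j.succ) (Matrix.single a b 1)) := by
  have hlin : ∃ A : Module.End ℂ (State q w), ∀ v, A v = applyRows τ (fun j => g j.succ) v := by
    generalize (fun j : Fin τ => g j.succ) = g'
    clear g
    induction τ with
    | zero => exact ⟨LinearMap.id, fun v => rfl⟩
    | succ τ ih =>
      obtain ⟨A, hA⟩ := ih fun j => g' j.succ
      exact ⟨A * gateLLGLin w (g' 0), fun v => hA _⟩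
  obtain ⟨A, hA⟩ := hlin
  rw [applyRows, ← hA, ← LinearMap.comp_apply, apply_eq_sum_single]
  refine Finset.sum_congr rfl fun a _ => Finset.sum_congr rfl fun b _ => ?_
  rw [LinearMap.comp_apply, hA, mul_comm]

/-- As the rows are independent, the average of the product of the light-like generators is the
power of the averaged one. -/
theorem integral_map_applyRows (hu : MeasurableGate u) {w : ℕ} (τ : ℕ)
    (ℓ : State q w →ₗ[ℂ] ℂ) (v : State q w) :
    Integrable (fun ω : Fin τ → Fin w → Ω => ℓ (applyRows τ (fun j k => u (ω j k)) v))
      (Measure.pi fun _ : Fin τ => Measure.pi fun _ : Fin w => P) ∧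
    ∫ ω : Fin τ → Fin w → Ω, ℓ (applyRows τ (fun j k => u (ω j k)) v)
      ∂(Measure.pi fun _ : Fin τ => Measure.pi fun _ : Fin w => P) =
      ℓ ((genT P u w ^ τ) v) := by
  induction τ generalizing v with
  | zero => simp [applyRows]
  | succ τ ih =>
    set μw : Measure (Fin w → Ω) := Measure.pi fun _ : Fin w => P with hμw
    have hmp := measurePreserving_piFinSuccAbove (fun _ : Fin (τ + 1) => μw) 0
    -- The integrand as a finite sum of products of functions of the first row and of the others.
    let F (p : (Fin w → Ω) × (Fin τ → Fin w → Ω)) : ℂ :=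
      ∑ a, ∑ b, gateLLG w (fun k => u (p.1 k)) v a b *
        ℓ (applyRows τ (fun j k => u (p.2 j k)) (Matrix.single a b 1))
    have hF : (fun ω : Fin (τ + 1) → Fin w → Ω => ℓ (applyRows (τ + 1) (fun j k => u (ω j k)) v)) =
        F ∘ MeasurableEquiv.piFinSuccAbove (fun _ => Fin w → Ω) 0 := by
      funext ω
      rw [map_applyRows_succ]
      rfl
    have hint : ∀ a b, Integrable (fun p : (Fin w → Ω) × (Fin τ → Fin w → Ω) =>
        gateLLG w (fun k => u (p.1 k)) v a b *
        ℓ (applyRows τ (fun j k => u (p.2 j k)) (Matrix.single a b 1)))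
        (μw.prod (Measure.pi fun _ : Fin τ => μw)) := fun a b =>
      ((bddMeasMatrix_gateLLG hu w v a b).integrable _).mul_prod (ih (Matrix.single a b 1)).1
    have hFint : Integrable F (μw.prod (Measure.pi fun _ : Fin τ => μw)) :=
      integrable_finsetSum _ fun a _ => integrable_finsetSum _ fun b _ => hint a b
    rw [hF]
    refine ⟨(hmp.integrable_comp_emb (MeasurableEquiv.measurableEmbedding _)).2 hFint, ?_⟩
    have h1 := hmp.integral_comp' (g := F)
    rw [show (∫ ω, (F ∘ MeasurableEquiv.piFinSuccAbove (fun _ => Fin w → Ω) 0) ω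
      ∂(Measure.pi fun _ : Fin (τ + 1) => μw)) = _ from h1]
    rw [integral_finsetSum _ fun a _ => integrable_finsetSum _ fun b _ => hint a b]
    rw [pow_succ, Module.End.mul_apply, ← LinearMap.comp_apply, apply_eq_sum_single]
    refine Finset.sum_congr rfl fun a _ => ?_
    rw [integral_finsetSum _ fun b _ => hint a b]
    refine Finset.sum_congr rfl fun b _ => ?_
    rw [integral_prod_mul (fun x : Fin w → Ω => gateLLG w (fun k => u (x k)) v a b)
      (fun y : Fin τ → Fin w → Ω => ℓ (applyRows τ (fun j k => u (y j k)) (Matrix.single a b 1))),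
      LinearMap.comp_apply, mul_comm]
    congr 1
    · exact (ih _).2
    · exact (map_genT P hu (Matrix.entryLinearMap ℂ ℂ a b) v).symm

theorem otoc_eq [NeZero q] (hu : MeasurableGate u) {w : ℕ} (hw : 1 ≤ w) (τ : ℕ)
    (μ ν : PauliIndex q) :
    otoc P u w τ μ ν = otocFunctional (siteOp w (w - 1) (pauli ν)) ((genT P u w ^ τ)
      ((siteOp w 0 (pauli μ)).conjTranspose ⊗ₖ siteOp w 0 (pauli μ))) := by
  rw [otoc]
  simp only [gateOTOC_eq hw]
  exact (integral_map_applyRows P hu τ _ _).2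

/-! ### Bounds on the correlator -/

theorem re_otoc_le [NeZero q] (hu : MeasurableGate u) {r₀ : ℝ} (hr₀ : 0 ≤ r₀)
    (h₀ : ∀ z : ℂ, (genF P u 1).HasEigenvalue z → ‖z‖ ≤ r₀) {w : ℕ} (hw : 1 ≤ w) {ρ : ℝ}
    (hρ : r₀ < ρ) (μ ν : PauliIndex q) :
    ∃ K : ℝ, 0 ≤ K ∧ ∀ τ : ℕ, (otoc P u w τ μ ν).re ≤ K * ρ ^ τ := by
  obtain ⟨K, hK0, hK⟩ := exists_tracelessWeight_le P hu hr₀ h₀ w hρ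
  set O := siteOp w 0 (pauli μ) with hO
  have hN := posFunctional_swapTrace q w O
  refine ⟨2 * ((q : ℝ) ^ w)⁻¹ * (K * (swapTrace q w (O.conjTranspose ⊗ₖ O)).re), by positivity,
    fun τ => ?_⟩
  rw [otoc_eq P hu hw]
  have h := fle_iff.1 ((otocFunctional_fle (siteOp_pauli_conjTranspose_mul w (w - 1) ν)).comp
    ((posMap_genT P hu w).pow τ)) O
  simp only [LinearMap.comp_apply, LinearMap.smul_apply, Complex.smul_re, smul_eq_mul] at h
  refine h.trans ?_
  calc _ ≤ 2 * ((q : ℝ) ^ w)⁻¹ * (K * ρ ^ τ * (swapTrace q w (O.conjTranspose ⊗ₖ O)).re) := by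
        gcongr
        exact hK τ O
    _ = _ := by ring

/-- Powers of `T_w` and of `F_w` differ by multiples of the identity only, on which the correlator
vanishes. -/
theorem exists_genT_pow_eq [NeZero q] (hu : MeasurableGate u) (w n : ℕ) (v : State q w) :
    ∃ c : ℂ, (genT P u w ^ n) v = (genF P u w ^ n) v + c • 1 := by
  induction n with
  | zero => exact ⟨0, by simp⟩
  | succ n ih =>
    obtain ⟨c, hc⟩ := ih
    refine ⟨((q : ℂ) ^ w)⁻¹ * swapTrace q w ((genF P u w ^ n) v) + c, ?_⟩
    rw [pow_succ', Module.End.mul_apply, hc, map_add, map_smul, genT_one P hu, pow_succ',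
      Module.End.mul_apply, genF_apply, add_smul]
    abel

theorem norm_otoc_le [NeZero q] (hu : MeasurableGate u) {w : ℕ} (hw : 1 ≤ w) {r : ℝ} (hr0 : 0 < r)
    (hr : ∀ z : ℂ, (genF P u w).HasEigenvalue z → ‖z‖ < r) (μ ν : PauliIndex q) :
    ∃ K : ℝ, 0 ≤ K ∧ ∀ τ : ℕ, ‖otoc P u w τ μ ν‖ ≤ K * r ^ τ := by
  set O := siteOp w 0 (pauli μ) with hO
  set B := siteOp w (w - 1) (pauli ν) with hB
  obtain ⟨K, hK0, hK⟩ := exists_norm_map_pow_le (genF P u w) hr0 hr (otocFunctional B)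
  have hN := posFunctional_swapTrace q w O
  refine ⟨K * (swapTrace q w (O.conjTranspose ⊗ₖ O)).re, by positivity, fun τ => ?_⟩
  obtain ⟨c, hc⟩ := exists_genT_pow_eq P hu w τ (O.conjTranspose ⊗ₖ O)
  rw [otoc_eq P hu hw, hc, map_add, map_smul,
    otocFunctional_one (siteOp_pauli_conjTranspose_mul w (w - 1) ν), smul_zero, add_zero]
  exact (hK τ O).trans (by rw [mul_right_comm])

/-! ### Leading eigenvalues -/

theorem genF_addLeft [NeZero q] (hu : MeasurableGate u) {w : ℕ} (v : State q w) :
    genF P u (w + 1) (addLeft v) = addLeft (genF P u w v) := by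
  have hq : (q : ℂ) ≠ 0 := NeZero.ne _
  have h1 : addLeft (1 : State q w) = 1 := by
    rw [← Matrix.one_kronecker_one, addLeft_kron, map_one, Matrix.one_kronecker_one]
  rw [genF_apply, genF_apply, genT_addLeft P hu, ← addLeftLin_apply (_ - _), map_sub, map_smul,
    addLeftLin_apply, addLeftLin_apply, h1, swapTrace_addLeft, pow_succ]
  congr 2
  field_simp

theorem addLeft_injective [NeZero q] {w : ℕ} :
    Function.Injective (addLeft : State q w → State q (w + 1)) := fun v v' h => by
  ext a b
  have := congrFun (congrFun h (Fin.cons (α := fun _ => Fin q) 0 a.1,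
    Fin.cons (α := fun _ => Fin q) 0 a.2)) (Fin.cons (α := fun _ => Fin q) 0 b.1,
    Fin.cons (α := fun _ => Fin q) 0 b.2)
  simpa [addLeft] using this

/-- The eigenvectors of `F_w` embed into the chain of `w + 1` sites as `𝟙 ⊗ v`. -/
theorem hasEigenvalue_genF_succ [NeZero q] (hu : MeasurableGate u) {w : ℕ} {z : ℂ}
    (h : (genF P u w).HasEigenvalue z) : (genF P u (w + 1)).HasEigenvalue z := by
  obtain ⟨v, hv⟩ := h.exists_hasEigenvector
  refine Module.End.hasEigenvalue_of_hasEigenvector (x := addLeft v)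
    (Module.End.hasEigenvector_iff.2 ⟨?_, fun h0 => hv.2 ?_⟩)
  · rw [Module.End.mem_eigenspace_iff, genF_addLeft P hu, hv.apply_eq_smul, ← addLeftLin_apply,
      map_smul, addLeftLin_apply]
  · apply addLeft_injective
    rw [h0, ← addLeftLin_apply, map_zero]

theorem hasEigenvalue_genF_of_one [NeZero q] (hu : MeasurableGate u) {z : ℂ}
    (h : (genF P u 1).HasEigenvalue z) {w : ℕ} (hw : 1 ≤ w) : (genF P u w).HasEigenvalue z := by
  induction w, hw using Nat.le_induction with
  | base => exact h
  | succ w _ ih => exact hasEigenvalue_genF_succ P hu ih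

end Rows

/-! ### Consequences of the liminf condition -/

section Liminf

variable {Ω : Type*} [MeasurableSpace Ω] {q : ℕ} [NeZero q] {P : Measure Ω} {u : Ω → Gate q}

/-- The liminf condition bounds the correlator below by a multiple of `|z| ^ τ`. The polynomial
factor is at least one and is dropped. The condition fails for `z = 0`, as division by zero gives
zero. -/
theorem LiminfCondition.exists_le {w : ℕ} {z : ℂ} {μ ν : PauliIndex q}
    (h : LiminfCondition P u w z μ ν) :
    0 < ‖z‖ ∧ ∃ c : ℝ, 0 < c ∧ ∀ᶠ τ : ℕ in atTop, c * ‖z‖ ^ τ ≤ (otoc P u w τ μ ν).re := by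
  obtain ⟨c, hc0, hc⟩ := EReal.lt_iff_exists_real_btwn.1 h
  have hc0 : 0 < c := by exact_mod_cast hc0
  have hev := eventually_lt_of_lt_liminf hc
  have hz : 0 < ‖z‖ := by
    obtain ⟨τ, hτ, hτ1⟩ := (hev.and (eventually_ge_atTop 1)).exists
    have hτ' := EReal.coe_lt_coe_iff.1 hτ
    refine norm_pos_iff.2 fun h0 => ?_
    rw [h0, norm_zero, zero_pow (by omega), mul_zero, div_zero] at hτ'
    exact hc0.not_gt hτ'
  refine ⟨hz, c, hc0, ?_⟩
  filter_upwards [hev, eventually_ge_atTop 1] with τ hτ hτ1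
  have hτ1' : (1 : ℝ) ≤ τ := by exact_mod_cast hτ1
  have hd : 0 < (τ : ℝ) ^ jordanExponent (genF P u w) * ‖z‖ ^ τ := by positivity
  have h1 := ((lt_div_iff₀ hd).1 (EReal.coe_lt_coe_iff.1 hτ)).le
  refine le_trans ?_ h1
  gcongr
  exact le_mul_of_one_le_left (by positivity) (one_le_pow₀ hτ1')

/-- An exponential that is dominated by all exponentials of larger rate than `r` has rate at most
`r`. -/
theorem le_of_eventually_pow_le {x r c : ℝ} (hc : 0 < c) (hr : 0 ≤ r)
    (h : ∀ ρ, r < ρ → ∃ K : ℝ, ∀ᶠ n : ℕ in atTop, c * x ^ n ≤ K * ρ ^ n) : x ≤ r := by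
  by_contra! hlt
  obtain ⟨ρ, hρ, hρx⟩ := exists_between hlt
  have hρ0 : 0 < ρ := hr.trans_lt hρ
  obtain ⟨K, hK⟩ := h ρ hρ
  have ht : Tendsto (fun n : ℕ => (x / ρ) ^ n) atTop atTop :=
    tendsto_pow_atTop_atTop_of_one_lt ((one_lt_div hρ0).2 hρx)
  obtain ⟨n, hn, hn'⟩ := (hK.and (ht.eventually_gt_atTop (K / c))).exists
  rw [div_lt_iff₀ hc, div_pow, div_mul_eq_mul_div, lt_div_iff₀ (pow_pos hρ0 n)] at hn'
  linarith

/-- A sequence between `c x ^ n` and all `K r ^ n`, `r > x`, has the exponential rate `x`. -/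
theorem tendsto_rpow_of_pow_bounds {f : ℕ → ℝ} {x c : ℝ} (hx : 0 < x) (hc : 0 < c)
    (hlow : ∀ᶠ n : ℕ in atTop, c * x ^ n ≤ f n)
    (hup : ∀ r, x < r → ∃ K : ℝ, ∀ n, f n ≤ K * r ^ n) :
    Tendsto (fun n : ℕ => f n ^ ((1 : ℝ) / (n : ℝ))) atTop (𝓝 x) := by
  have hconst : ∀ K : ℝ, 0 < K → Tendsto (fun n : ℕ => K ^ ((1 : ℝ) / (n : ℝ))) atTop (𝓝 1) :=
    fun K hK => by
      have := (Real.continuous_const_rpow hK.ne').tendsto 0 |>.comp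
        tendsto_one_div_atTop_nhds_zero_nat
      simpa [Function.comp_def] using this
  have hroot : ∀ (K r : ℝ) (n : ℕ), 0 < K → 0 < r → 1 ≤ n →
      (K * r ^ n) ^ ((1 : ℝ) / (n : ℝ)) = K ^ ((1 : ℝ) / (n : ℝ)) * r := fun K r n hK hr hn => by
    rw [Real.mul_rpow hK.le (by positivity), one_div, Real.pow_rpow_inv_natCast hr.le (by omega)]
  refine tendsto_order.2 ⟨fun a ha => ?_, fun b hb => ?_⟩
  · have ht : Tendsto (fun n : ℕ => c ^ ((1 : ℝ) / (n : ℝ)) * x) atTop (𝓝 (1 * x)) :=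
      (hconst c hc).mul_const x
    rw [one_mul] at ht
    filter_upwards [ht.eventually_const_lt ha, hlow, eventually_ge_atTop 1] with n h1 h2 h3
    rw [← hroot c x n hc hx h3] at h1
    exact h1.trans_le (Real.rpow_le_rpow (by positivity) h2 (by positivity))
  · obtain ⟨r, hxr, hrb⟩ := exists_between hb
    have hr : 0 < r := hx.trans hxr
    obtain ⟨K, hK⟩ := hup r hxr
    have hK' : ∀ n, f n ≤ max K 1 * r ^ n := fun n =>
      (hK n).trans (by gcongr; exact le_max_left _ _)
    have hK0 : 0 < max K 1 := lt_max_of_lt_right one_pos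
    have ht : Tendsto (fun n : ℕ => max K 1 ^ ((1 : ℝ) / (n : ℝ)) * r) atTop (𝓝 (1 * r)) :=
      (hconst _ hK0).mul_const r
    rw [one_mul] at ht
    filter_upwards [ht.eventually_lt_const hrb, hlow, eventually_ge_atTop 1] with n h1 h2 h3
    rw [← hroot _ r n hK0 hr h3] at h1
    have hf : 0 ≤ f n := le_trans (by positivity) h2
    exact (Real.rpow_le_rpow hf (hK' n) (by positivity)).trans_lt h1

end Liminf

end LightLikeOTOC

theorem mainTheorem2 {q : ℕ} [NeZero q] {Ω : Type*} [MeasurableSpace Ω]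
    (P : MeasureTheory.Measure Ω) [MeasureTheory.IsProbabilityMeasure P]
    (u : Ω → LightLikeOTOC.Gate q)
    (hu : ∀ i j, Measurable fun ω => (u ω : Matrix (Fin q × Fin q) (Fin q × Fin q) ℂ) i j)
    (z₂ : ℕ → ℂ)
    (hz : ∀ w : ℕ, 1 ≤ w →
      LightLikeOTOC.IsLeadingEigenvalue (LightLikeOTOC.genF P u w) (z₂ w))
    (hC : ∀ w : ℕ, 1 ≤ w → ∃ μ ν : LightLikeOTOC.PauliIndex q,
      LightLikeOTOC.LiminfCondition P u w (z₂ w) μ ν) :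
    ∀ w : ℕ, 1 ≤ w →
      ‖z₂ w‖ = ‖z₂ 1‖ ∧
      LightLikeOTOC.IsLeadingEigenvalue (LightLikeOTOC.genF P u w) (z₂ 1) ∧
      ((∀ z : ℂ, LightLikeOTOC.IsLeadingEigenvalue (LightLikeOTOC.genF P u w) z → z = z₂ w) →
        z₂ w = z₂ 1) ∧
      ∀ μ ν : LightLikeOTOC.PauliIndex q,
        LightLikeOTOC.LiminfCondition P u w (z₂ w) μ ν →
        Filter.Tendsto (fun τ : ℕ => ‖LightLikeOTOC.otoc P u w τ μ ν‖ ^ ((1 : ℝ) / (τ : ℝ)))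
          Filter.atTop (nhds ‖z₂ 1‖) := by
  intro w hw
  have heig := LightLikeOTOC.hasEigenvalue_genF_of_one P hu (hz 1 le_rfl).1 hw
  have hnorm : ‖z₂ w‖ = ‖z₂ 1‖ := by
    refine le_antisymm ?_ ((hz w hw).2 _ heig)
    obtain ⟨μ, ν, hμν⟩ := hC w hw
    obtain ⟨-, c, hc, hlow⟩ := hμν.exists_le
    refine LightLikeOTOC.le_of_eventually_pow_le hc (norm_nonneg _) fun ρ hρ => ?_
    obtain ⟨K, -, hK⟩ := LightLikeOTOC.re_otoc_le P hu (norm_nonneg _) (hz 1 le_rfl).2 hw hρ μ ν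
    exact ⟨K, hlow.mono fun τ hτ => hτ.trans (hK τ)⟩
  have hlead : LightLikeOTOC.IsLeadingEigenvalue (LightLikeOTOC.genF P u w) (z₂ 1) :=
    ⟨heig, fun z hz' => hnorm ▸ (hz w hw).2 z hz'⟩
  refine ⟨hnorm, hlead, fun huniq => (huniq _ hlead).symm, fun μ ν hμν => ?_⟩
  obtain ⟨hpos, c, hc, hlow⟩ := hμν.exists_le
  rw [← hnorm]
  refine LightLikeOTOC.tendsto_rpow_of_pow_bounds hpos hc
    (hlow.mono fun τ hτ => hτ.trans (Complex.re_le_norm _)) fun r hr => ?_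
  obtain ⟨K, -, hK⟩ := LightLikeOTOC.norm_otoc_le P hu hw (hpos.trans hr)
    (fun z hz' => ((hz w hw).2 z hz').trans_lt hr) μ ν
  exact ⟨K, hK⟩
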